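/- For $n\ge 1$ let $HYP_n$ (the hypermetric cone on $n$ points) be the set of all vectors $d=(d_{ij})_{1\le i<j\le n}\in\mathbb R^{\binom n2}$ such that $\sum_{1\le i<j\le n} b_ib_jd_{ij}\le 0$ for every $b\in\mathbb Z^n$ with $\sum_{i=1}^n b_i=1$. A facet of a convex cone $C$ is a face of $C$ of dimension $\dim C-1$. The symmetric group $\mathrm{Sym}(n)$ acts on $HYP_n$ by permuting the $n$ points, hence on the set of its facets. Theorem. $HYP_8$ has at least $298592$ facets, and its facets form at least $86$ orbits under $\mathrm{Sym}(8)$. -/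

import Mathlib

namespace Hypermetric

/-- Distance vectors `(d i j)` with `i < j` on `n` points, i.e. the space `ℝ ^ (n choose 2)`. -/
abbrev DistVec (n : ℕ) : Type := {p : Fin n × Fin n // p.1 < p.2} → ℝ

/-- The value `d i j` for arbitrary `i` and `j`, with `d j i = d i j` and `d i i = 0`. -/
def DistVec.dist {n : ℕ} (d : DistVec n) (i j : Fin n) : ℝ :=
  if h : i < j then d ⟨(i, j), h⟩ else if h : j < i then d ⟨(j, i), h⟩ else 0

/-- `H(b) d`, the sum over `i < j` of `b i * b j * d i j`. -/
def H {n : ℕ} (b : Fin n → ℤ) (d : DistVec n) : ℝ :=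
  ∑ p : {p : Fin n × Fin n // p.1 < p.2}, (b p.1.1 : ℝ) * (b p.1.2 : ℝ) * d p

/-- The hypermetric cone on `n` points. -/
def HYP (n : ℕ) : PointedCone ℝ (DistVec n) where
  carrier := {d | ∀ b : Fin n → ℤ, ∑ i, b i = 1 → H b d ≤ 0}
  add_mem' := by
    intro x y hx hy b hb
    have h : H b (x + y) = H b x + H b y := by
      simp [H, mul_add, Finset.sum_add_distrib]
    rw [h]
    exact add_nonpos (hx b hb) (hy b hb)
  zero_mem' := by
    intro b _
    simp [H]
  smul_mem' := by
    intro c x hx b hb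
    have h : H b (c • x) = (c : ℝ) * H b x := by
      simp only [H, Finset.mul_sum]
      refine Finset.sum_congr rfl fun p _ => ?_
      change _ * _ * ((c : ℝ) * x p) = _
      ring
    rw [h]
    exact mul_nonpos_of_nonneg_of_nonpos c.2 (hx b hb)

/-- A facet of a convex cone `C`: a face whose dimension is one less than that of `C`. -/
def IsFacet {E : Type*} [AddCommGroup E] [Module ℝ E] (C F : PointedCone ℝ E) : Prop :=
  F.IsFaceOf C ∧
    Module.finrank ℝ (Submodule.span ℝ (F : Set E)) + 1 =
      Module.finrank ℝ (Submodule.span ℝ (C : Set E))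

/-- The set of all facets of a convex cone. -/
def facets {E : Type*} [AddCommGroup E] [Module ℝ E] (C : PointedCone ℝ E) :
    Set (PointedCone ℝ E) :=
  {F | IsFacet C F}

/-- The relabelling of the points by a permutation `σ`: it sends `d` to the distance vector with
entries `d (σ i) (σ j)`. -/
def relabel {n : ℕ} (σ : Equiv.Perm (Fin n)) : DistVec n →ₗ[ℝ] DistVec n where
  toFun d := fun p => d.dist (σ p.1.1) (σ p.1.2)
  map_add' x y := by
    funext p
    simp only [DistVec.dist, Pi.add_apply]
    split_ifs <;> simp
  map_smul' c x := by
    funext p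
    simp only [DistVec.dist, Pi.smul_apply, RingHom.id_apply]
    split_ifs <;> simp

/-- The orbit of a cone `F` of distance vectors under the symmetric group on the `n` points. -/
def orbit {n : ℕ} (F : PointedCone ℝ (DistVec n)) : Set (PointedCone ℝ (DistVec n)) :=
  Set.range fun σ : Equiv.Perm (Fin n) => F.map (relabel σ)

/-- The set of all orbits of facets of the hypermetric cone on `n` points. -/
def facetOrbits (n : ℕ) : Set (Set (PointedCone ℝ (DistVec n))) :=
  orbit '' facets (HYP n)

end Hypermetric

/-!
The facets in question are of the form `face b`: the hypermetrics which satisfy the inequality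
`H b d ≤ 0` of an integer vector `b` with sum `1` with equality. The space of distance vectors on
eight points has dimension `28`, so `face b` is a facet as soon as it contains `27` linearly independent
hypermetrics and some hypermetric violates the equality (`HasTightBasis.isFacet`). If `b` has at
least three nonzero entries, then the facet determines `b`, because it determines the products
`b i * b j` with `i ≠ j` up to a factor (`HasTightBasis.eq_of_face_eq`). A permutation of the points
maps `face b` to `face (b ∘ σ)` (`map_relabel_face`), so orbits of such facets correspond to
vectors `b` up to the order of the entries. For the `86` vectors in `reps` the orbits have `298592`
elements in total, by the orbit-stabilizer theorem (`card_rearrangements`).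

It remains to exhibit tight hypermetrics for each of the `86` vectors. They come from three
families. Most of them are cut metrics. The others are squared distances of points on a sphere in
an affine lattice with no lattice point inside the sphere; the defining inequalities of the cone
hold because `H b D` is minus the value, at the point with the barycentric coordinates `b`, of a
quadratic function which vanishes on the sphere and is positive outside (`mem_HYP_of_nonneg`). The
points are vertices of the Gosset polytope `3₂₁` (`gosset_mem_HYP`) or of the Erdahl–Rybnikov
polytope (`er_mem_HYP`). For each vector the list `certificates` names `27` tight hypermetrics by
integer codes, and their linear independence, together with that of one cut which is not tight, is
tested by elimination modulo `31` on rows packed into single natural numbers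
(`eq_zero_of_eliminate`). The kernel evaluates the tests (`check_certificates`).
-/

namespace Hypermetric

/-! ### Faces given by hypermetric inequalities -/

section General

variable {n : ℕ}

/-- `H b` as a linear functional. -/
def HLin (b : Fin n → ℤ) : DistVec n →ₗ[ℝ] ℝ where
  toFun := H b
  map_add' x y := by simp [H, mul_add, Finset.sum_add_distrib]
  map_smul' c x := by
    simp only [H, Finset.mul_sum, Pi.smul_apply, smul_eq_mul, RingHom.id_apply]
    exact Finset.sum_congr rfl fun p _ => by ring

@[simp] lemma HLin_apply (b : Fin n → ℤ) (d : DistVec n) : HLin b d = H b d := rfl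

/-- The part of the hypermetric cone on which the inequality given by `b` is an equality. -/
def face (b : Fin n → ℤ) : PointedCone ℝ (DistVec n) where
  carrier := {d | d ∈ HYP n ∧ H b d = 0}
  add_mem' {x y} hx hy := ⟨add_mem hx.1 hy.1, by
    rw [← HLin_apply, map_add, HLin_apply, HLin_apply, hx.2, hy.2, add_zero]⟩
  zero_mem' := ⟨zero_mem _, map_zero (HLin b)⟩
  smul_mem' c x hx := ⟨Submodule.smul_mem _ c hx.1, by
    change H b ((c : ℝ) • x) = 0
    rw [← HLin_apply, map_smul, HLin_apply, hx.2, smul_zero]⟩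

lemma face_isFaceOf {b : Fin n → ℤ} (hb : ∑ i, b i = 1) : (face b).IsFaceOf (HYP n) where
  le := fun _ h => h.1
  mem_of_smul_add_mem {x y a} hx hy ha h := by
    refine ⟨hx, ?_⟩
    have h0 : a * H b x + H b y = 0 := by
      have := h.2
      rwa [← HLin_apply, map_add, map_smul] at this
    nlinarith [hx b hb, hy b hb]

lemma DistVec.dist_self (d : DistVec n) (i : Fin n) : d.dist i i = 0 := by simp [DistVec.dist]

lemma DistVec.dist_comm (d : DistVec n) (i j : Fin n) : d.dist i j = d.dist j i := by
  rcases lt_trichotomy i j with h | rfl | h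
  · simp [DistVec.dist, h, h.not_gt]
  · rfl
  · simp [DistVec.dist, h, h.not_gt]

lemma DistVec.dist_of_lt (d : DistVec n) {i j : Fin n} (h : i < j) :
    d.dist i j = d ⟨(i, j), h⟩ := by simp [DistVec.dist, h]

lemma DistVec.dist_relabel (σ : Equiv.Perm (Fin n)) (d : DistVec n) (i j : Fin n) :
    (relabel σ d).dist i j = d.dist (σ i) (σ j) := by
  rcases lt_trichotomy i j with h | rfl | h
  · rw [DistVec.dist_of_lt _ h]; rfl
  · rw [DistVec.dist_self, DistVec.dist_self]
  · rw [DistVec.dist_comm, DistVec.dist_of_lt _ h, DistVec.dist_comm d]; rfl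

lemma relabel_relabel (σ τ : Equiv.Perm (Fin n)) (d : DistVec n) :
    relabel σ (relabel τ d) = relabel (τ * σ) d := by
  funext p
  exact DistVec.dist_relabel τ d _ _

lemma relabel_one (d : DistVec n) : relabel 1 d = d := by
  funext p
  exact DistVec.dist_of_lt d p.2

lemma relabel_injective (σ : Equiv.Perm (Fin n)) : Function.Injective (relabel σ) := by
  intro x y h
  have := congrArg (relabel σ⁻¹) h
  simpa [relabel_relabel, relabel_one] using this

/-- A sum over unordered pairs is half a double sum. The double sum is invariant under permutations
of the points, while the pairs `i < j` are not. -/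
lemma sum_sum_eq_two_mul_sum_pairs {R : Type*} [CommRing R] (f : Fin n → Fin n → R)
    (hs : ∀ i j, f i j = f j i) (h0 : ∀ i, f i i = 0) :
    ∑ i, ∑ j, f i j = 2 * ∑ p : {p : Fin n × Fin n // p.1 < p.2}, f p.1.1 p.1.2 := by
  rw [← Fintype.sum_prod_type' f, ← Finset.sum_filter_add_sum_filter_not _ (fun p => p.1 < p.2),
    two_mul]
  have h1 : ∑ p : {p : Fin n × Fin n // p.1 < p.2}, f p.1.1 p.1.2 =
      ∑ p : Fin n × Fin n with p.1 < p.2, f p.1 p.2 :=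
    (Finset.sum_subtype _ (by simp) fun p : Fin n × Fin n => f p.1 p.2).symm
  rw [h1]
  congr 1
  rw [← Finset.sum_filter_add_sum_filter_not (Finset.univ.filter fun p : Fin n × Fin n =>
    ¬ p.1 < p.2) (fun p => p.2 < p.1)]
  rw [Finset.sum_eq_zero (s := (Finset.univ.filter fun p : Fin n × Fin n =>
    ¬ p.1 < p.2).filter fun p => ¬ p.2 < p.1), add_zero]
  · refine Finset.sum_equiv (Equiv.prodComm _ _) (fun p => ?_) fun p _ => hs _ _
    simp only [Finset.mem_filter, Finset.mem_univ, true_and, Equiv.prodComm_apply,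
      Prod.fst_swap, Prod.snd_swap]
    exact ⟨fun h => h.2, fun h => ⟨h.not_gt, h⟩⟩
  · intro p hp
    simp only [Finset.mem_filter, Finset.mem_univ, true_and, not_lt] at hp
    rw [le_antisymm hp.1 hp.2, h0]

lemma two_mul_H (b : Fin n → ℤ) (d : DistVec n) :
    2 * H b d = ∑ i, ∑ j, (b i : ℝ) * (b j : ℝ) * d.dist i j := by
  rw [sum_sum_eq_two_mul_sum_pairs]
  · congr 1
    exact Finset.sum_congr rfl fun p _ => by rw [DistVec.dist_of_lt _ p.2]
  · intro i j
    rw [DistVec.dist_comm]; ring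
  · intro i
    rw [DistVec.dist_self, mul_zero]

lemma H_relabel (σ : Equiv.Perm (Fin n)) (b : Fin n → ℤ) (d : DistVec n) :
    H (b ∘ σ) (relabel σ d) = H b d := by
  have h : 2 * H (b ∘ σ) (relabel σ d) = 2 * H b d := by
    rw [two_mul_H, two_mul_H]
    simp only [DistVec.dist_relabel, Function.comp_apply]
    rw [← Equiv.sum_comp σ fun i => ∑ j, (b i : ℝ) * (b j : ℝ) * d.dist i j]
    exact Finset.sum_congr rfl fun i _ =>
      Equiv.sum_comp σ fun j => (b (σ i) : ℝ) * (b j : ℝ) * d.dist (σ i) j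
  linarith

lemma relabel_mem_HYP (σ : Equiv.Perm (Fin n)) {d : DistVec n} (hd : d ∈ HYP n) :
    relabel σ d ∈ HYP n := by
  intro b hb
  have := hd (b ∘ ⇑σ⁻¹) (by rw [← hb]; exact Equiv.sum_comp σ⁻¹ b)
  rw [← H_relabel σ] at this
  simpa [Function.comp_assoc] using this

lemma relabel_mem_face (σ : Equiv.Perm (Fin n)) {b : Fin n → ℤ} {d : DistVec n}
    (hd : d ∈ face b) : relabel σ d ∈ face (b ∘ σ) :=
  ⟨relabel_mem_HYP σ hd.1, by rw [H_relabel, hd.2]⟩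

lemma map_relabel_face (σ : Equiv.Perm (Fin n)) (b : Fin n → ℤ) :
    (face b).map (relabel σ) = face (b ∘ σ) := by
  ext d
  rw [PointedCone.mem_map]
  constructor
  · rintro ⟨x, hx, rfl⟩
    exact relabel_mem_face σ hx
  · intro hd
    refine ⟨relabel σ⁻¹ d, ?_, by simp [relabel_relabel, relabel_one]⟩
    have := relabel_mem_face σ⁻¹ hd
    simpa [Function.comp_assoc] using this

/-- The coefficients `b` have sum `1`, and the space has a basis of hypermetrics all of which but
the last satisfy the inequality of `b` with equality. Such an inequality defines a facet. -/
def HasTightBasis (b : Fin n → ℤ) : Prop :=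
  ∑ i, b i = 1 ∧ ∃ (m : ℕ) (x : Fin (m + 1) → DistVec n), m + 1 = Module.finrank ℝ (DistVec n) ∧
    LinearIndependent ℝ x ∧ (∀ k, x k ∈ HYP n) ∧ (∀ k : Fin m, H b (x k.castSucc) = 0) ∧
    H b (x (Fin.last m)) ≠ 0

lemma HasTightBasis.comp {b : Fin n → ℤ} (h : HasTightBasis b) (σ : Equiv.Perm (Fin n)) :
    HasTightBasis (b ∘ σ) := by
  obtain ⟨hb, m, x, hm, hx, h1, h2, h3⟩ := h
  refine ⟨by rw [← hb]; exact Equiv.sum_comp σ b, m, fun k => relabel σ (x k), hm,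
    hx.map' _ (LinearMap.ker_eq_bot.2 (relabel_injective σ)), fun k => relabel_mem_HYP σ (h1 k),
    fun k => ?_, ?_⟩
  · rw [H_relabel, h2]
  · rwa [H_relabel]

/-- The tight hypermetrics of the basis already span the kernel of `H b`, which is a hyperplane. -/
lemma HasTightBasis.span_face {b : Fin n → ℤ} (h : HasTightBasis b) :
    Submodule.span ℝ (face b : Set (DistVec n)) = LinearMap.ker (HLin b) := by
  obtain ⟨hb, m, x, hm, hx, h1, h2, h3⟩ := h
  have hle : Submodule.span ℝ (face b : Set (DistVec n)) ≤ LinearMap.ker (HLin b) :=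
    Submodule.span_le.2 fun d hd => hd.2
  refine Submodule.eq_of_le_of_finrank_le hle ?_
  have hker := Module.Dual.finrank_ker_add_one_of_ne_zero (f := HLin b)
    fun h => h3 (by rw [← HLin_apply, h, LinearMap.zero_apply])
  have hli : LinearIndependent ℝ fun k : Fin m => x k.castSucc :=
    hx.comp _ (Fin.castSucc_injective m)
  have hspan := finrank_span_eq_card hli
  rw [Fintype.card_fin] at hspan
  have hsub : Submodule.span ℝ (Set.range fun k : Fin m => x k.castSucc) ≤
      Submodule.span ℝ (face b : Set (DistVec n)) :=
    Submodule.span_mono (by rintro _ ⟨k, rfl⟩; exact ⟨h1 _, h2 k⟩)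
  have := Submodule.finrank_mono hsub
  omega

lemma HasTightBasis.isFacet {b : Fin n → ℤ} (h : HasTightBasis b) : IsFacet (HYP n) (face b) := by
  refine ⟨face_isFaceOf h.1, ?_⟩
  rw [h.span_face]
  obtain ⟨hb, m, x, hm, hx, h1, h2, h3⟩ := h
  rw [Module.Dual.finrank_ker_add_one_of_ne_zero (f := HLin b)
    fun h => h3 (by rw [← HLin_apply, h, LinearMap.zero_apply])]
  have htop : Submodule.span ℝ (HYP n : Set (DistVec n)) = ⊤ := by
    rw [eq_top_iff, ← hx.span_eq_top_of_card_eq_finrank (by simpa using hm)]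
    exact Submodule.span_mono (by rintro _ ⟨k, rfl⟩; exact h1 k)
  rw [htop, finrank_top]

lemma H_single (b : Fin n → ℤ) (p : {p : Fin n × Fin n // p.1 < p.2}) :
    H b (Pi.single p 1) = b p.1.1 * b p.1.2 := by
  rw [H, Finset.sum_eq_single p]
  · simp
  · intro q _ hq
    simp [Pi.single_eq_of_ne hq]
  · simp

/-- Two integer vectors with sum `1`, one of which has three nonzero entries, coincide if the
products of distinct entries are proportional. -/
lemma eq_of_mul_eq {b b' : Fin n → ℤ} {c : ℝ} (hb : ∑ i, b i = 1) (hb' : ∑ i, b' i = 1)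
    (hc : ∀ i j, i ≠ j → (b i : ℝ) * b j = c * (b' i * b' j))
    {i j k : Fin n} (hij : i ≠ j) (hik : i ≠ k) (hjk : j ≠ k)
    (hi : b i ≠ 0) (hj : b j ≠ 0) (hk : b k ≠ 0) : b = b' := by
  have hi' : (b i : ℝ) ≠ 0 := by exact_mod_cast hi
  have hj' : (b j : ℝ) ≠ 0 := by exact_mod_cast hj
  have hk' : (b k : ℝ) ≠ 0 := by exact_mod_cast hk
  have hsq : (b i : ℝ) * b i = c * (b' i * b' i) := by
    apply mul_right_cancel₀ (mul_ne_zero hj' hk')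
    have h1 := hc i j hij
    have h2 := hc i k hik
    have h3 := hc j k hjk
    calc (b i : ℝ) * b i * (b j * b k) = (b i * b j) * (b i * b k) := by ring
      _ = c * (b' i * b' i) * (c * (b' j * b' k)) := by rw [h1, h2]; ring
      _ = _ := by rw [← h3]
  have hprop : ∀ l, (b l : ℝ) * b' i = b' l * b i := by
    intro l
    by_cases hl : l = i
    · subst hl; ring
    · apply mul_right_cancel₀ hi'
      calc (b l : ℝ) * b' i * b i = (b l * b i) * b' i := by ring
        _ = b' l * (c * (b' i * b' i)) := by rw [hc l i hl]; ring
        _ = b' l * b i * b i := by rw [← hsq]; ring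
  have hsum : (b' i : ℝ) = b i := by
    have h1 : (∑ l, (b l : ℝ)) = 1 := by exact_mod_cast hb
    have h2 : (∑ l, (b' l : ℝ)) = 1 := by exact_mod_cast hb'
    calc (b' i : ℝ) = ∑ l, (b l : ℝ) * b' i := by rw [← Finset.sum_mul, h1, one_mul]
      _ = ∑ l, (b' l : ℝ) * b i := Finset.sum_congr rfl fun l _ => hprop l
      _ = b i := by rw [← Finset.sum_mul, h2, one_mul]
  funext l
  have := hprop l
  rw [hsum] at this
  exact_mod_cast mul_right_cancel₀ hi' this

/-- The facet determines the functional `H b` up to a scalar, hence the products `b i * b j`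
with `i ≠ j` up to a scalar. -/
lemma HasTightBasis.eq_of_face_eq {b b' : Fin n → ℤ} (h : HasTightBasis b) (h' : HasTightBasis b')
    (hf : face b = face b') {i j k : Fin n} (hij : i ≠ j) (hik : i ≠ k) (hjk : j ≠ k)
    (hi : b i ≠ 0) (hj : b j ≠ 0) (hk : b k ≠ 0) : b = b' := by
  have hker : LinearMap.ker (HLin b') ≤ LinearMap.ker (HLin b) := by
    rw [← h.span_face, ← h'.span_face, hf]
  obtain ⟨c, hc⟩ : ∃ c : ℝ, c • HLin b' = HLin b := by
    have := mem_span_of_iInf_ker_le_ker (L := fun _ : Unit => HLin b') (K := HLin b) (by simpa)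
    rwa [Set.range_const, Submodule.mem_span_singleton] at this
  have hlt : ∀ i j, i < j → (b i : ℝ) * b j = c * (b' i * b' j) := by
    intro i j hij
    have := congrArg (fun f => f (Pi.single ⟨(i, j), hij⟩ 1)) hc
    simp only [LinearMap.smul_apply, HLin_apply, H_single, smul_eq_mul] at this
    exact this.symm
  refine eq_of_mul_eq (c := c) h.1 h'.1 (fun i j hij => ?_) hij hik hjk hi hj hk
  rcases lt_or_gt_of_ne hij with hl | hl
  · exact hlt i j hl
  · rw [mul_comm, hlt j i hl, mul_comm (b' j : ℝ)]

end General

/-! ### Hypermetrics from empty spheres -/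

lemma affine_modEq {n : ℕ} {b f : Fin n → ℤ} {r m : ℤ} (hb : ∑ i, b i = 1)
    (hf : ∀ i, f i ≡ r [ZMOD m]) : ∑ i, b i * f i ≡ r [ZMOD m] := by
  have h : ∑ i, b i * f i - r = ∑ i, b i * (f i - r) := by
    simp only [mul_sub, Finset.sum_sub_distrib, ← Finset.sum_mul, hb, one_mul]
  rw [Int.modEq_comm, Int.modEq_iff_dvd, h]
  exact Finset.dvd_sum fun i _ => Dvd.dvd.mul_left (Int.modEq_iff_dvd.1 (hf i).symm) _

/-- For the squared distances `D` of points `v i` in a diagonal quadratic form `q`, the value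
`H b D` compares the mean of the `q (v i)` with weights `b i` to the value of `q` at the mean. -/
lemma H_eq_sub {n : ℕ} {κ : Type*} [Fintype κ] {c : κ → ℤ} {v : Fin n → κ → ℤ}
    {D : Fin n → Fin n → ℕ} (hD : ∀ i j, (D i j : ℤ) = ∑ k, c k * (v i k - v j k) ^ 2)
    {b : Fin n → ℤ} (hb : ∑ i, b i = 1) :
    H b (fun p => (D p.1.1 p.1.2 : ℝ) : DistVec n) =
      ((∑ k, c k * ∑ i, b i * v i k ^ 2 - ∑ k, c k * (∑ i, b i * v i k) ^ 2 : ℤ) : ℝ) := by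
  have hcast : H b (fun p => (D p.1.1 p.1.2 : ℝ) : DistVec n) =
      ((∑ p : {p : Fin n × Fin n // p.1 < p.2},
        b p.1.1 * b p.1.2 * (D p.1.1 p.1.2 : ℤ) : ℤ) : ℝ) := by
    push_cast; rfl
  rw [hcast, Int.cast_inj]
  apply mul_left_cancel₀ (two_ne_zero (α := ℤ))
  have h2 : (2 * ∑ p : {p : Fin n × Fin n // p.1 < p.2},
      b p.1.1 * b p.1.2 * (D p.1.1 p.1.2 : ℤ)) =
      ∑ i, ∑ j, b i * b j * ∑ k, c k * (v i k - v j k) ^ 2 := by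
    rw [← sub_eq_zero,
      sum_sum_eq_two_mul_sum_pairs (fun i j => b i * b j * ∑ k, c k * (v i k - v j k) ^ 2),
      ← mul_sub, ← Finset.sum_sub_distrib, Finset.sum_eq_zero, mul_zero]
    · intro p _
      rw [← hD]; ring
    · intro i j
      rw [mul_comm (b i)]
      congr 1
      exact Finset.sum_congr rfl fun k _ => by ring
    · intro i
      simp
  have h3 : ∀ k, ∑ i, ∑ j, b i * b j * (c k * (v i k - v j k) ^ 2) =
      2 * (c k * ∑ i, b i * v i k ^ 2) - 2 * (c k * (∑ i, b i * v i k) ^ 2) := by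
    intro k
    have e1 : ∀ i j, b i * b j * (c k * (v i k - v j k) ^ 2) =
        c k * ((b i * v i k ^ 2) * b j + b i * (b j * v j k ^ 2)
          - 2 * ((b i * v i k) * (b j * v j k))) := fun i j => by ring
    simp only [e1, ← Finset.mul_sum, Finset.sum_add_distrib, Finset.sum_sub_distrib,
      ← Finset.sum_mul, hb]
    ring
  have h4 : ∑ i, ∑ j, b i * b j * ∑ k, c k * (v i k - v j k) ^ 2 =
      ∑ k, (2 * (c k * ∑ i, b i * v i k ^ 2) - 2 * (c k * (∑ i, b i * v i k) ^ 2)) := by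
    simp_rw [← h3]
    simp only [Finset.mul_sum]
    exact (Finset.sum_congr rfl fun i _ => Finset.sum_comm).trans Finset.sum_comm
  rw [h2, h4, Finset.sum_sub_distrib, ← Finset.mul_sum, ← Finset.mul_sum, mul_sub]

/-- **Empty spheres give hypermetrics.** Let `f x = ∑ c k * x k ^ 2 + ∑ l k * x k + e` vanish at the
points `v i` and be nonnegative at their affine integer combinations, so that the points lie on a
sphere with none of the combinations inside. Then the squared distances of the `v i` in the
quadratic form with the coefficients `c` belong to the hypermetric cone, since `H b D` is minus the
value of `f` at the combination with the coefficients `b`. -/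
theorem mem_HYP_of_nonneg {n : ℕ} {κ : Type*} [Fintype κ] (c l : κ → ℤ) (e : ℤ)
    (v : Fin n → κ → ℤ) (D : Fin n → Fin n → ℕ)
    (hD : ∀ i j, (D i j : ℤ) = ∑ k, c k * (v i k - v j k) ^ 2)
    (hv : ∀ i, ∑ k, (c k * v i k ^ 2 + l k * v i k) + e = 0)
    (hpos : ∀ b : Fin n → ℤ, ∑ i, b i = 1 →
      0 ≤ ∑ k, (c k * (∑ i, b i * v i k) ^ 2 + l k * ∑ i, b i * v i k) + e) :
    (fun p => (D p.1.1 p.1.2 : ℝ) : DistVec n) ∈ HYP n := by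
  intro b hb
  have h5 : ∑ k, (c k * ∑ i, b i * v i k ^ 2) + ∑ k, l k * ∑ i, b i * v i k + e = 0 := by
    have : ∑ i, b i * (∑ k, (c k * v i k ^ 2 + l k * v i k) + e) = 0 :=
      Finset.sum_eq_zero fun i _ => by rw [hv, mul_zero]
    simp only [mul_add, Finset.sum_add_distrib, ← Finset.sum_mul, hb, one_mul,
      Finset.mul_sum] at this ⊢
    rw [Finset.sum_comm, Finset.sum_comm (s := Finset.univ (α := κ))
      (f := fun k i => l k * (b i * v i k))]
    rw [← this]
    simp only [mul_left_comm]
  have h6 := hpos b hb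
  rw [H_eq_sub hD hb, ← Int.cast_zero, Int.cast_le]
  rw [Finset.sum_add_distrib] at h6
  linarith

/-! ### Three families of hypermetrics -/

/-- The cut metric of the set whose members are the binary digits `1` of `s`. -/
def cutDist (s i j : ℕ) : ℕ := ((s >>> i) % 2 + (s >>> j) % 2) % 2

lemma cast_cutDist {n : ℕ} (s : ℕ) (i j : Fin n) : (cutDist s i j : ℤ) = ∑ _k : Unit, 1 *
    ((((s >>> (i : ℕ)) % 2 : ℕ) : ℤ) - (((s >>> (j : ℕ)) % 2 : ℕ) : ℤ)) ^ 2 := by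
  simp only [cutDist, Finset.univ_unique, Finset.sum_singleton]
  rcases Nat.mod_two_eq_zero_or_one (s >>> (i : ℕ)) with h | h <;>
  rcases Nat.mod_two_eq_zero_or_one (s >>> (j : ℕ)) with h' | h' <;> simp [h, h']

lemma H_cutDist {n : ℕ} (s : ℕ) {b : Fin n → ℤ} (hb : ∑ i, b i = 1) :
    H b (fun p => (cutDist s p.1.1 p.1.2 : ℝ)) =
      ((∑ i : Fin n, b i * ((s >>> (i : ℕ)) % 2 : ℕ)) -
        (∑ i : Fin n, b i * ((s >>> (i : ℕ)) % 2 : ℕ)) ^ 2 : ℤ) := by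
  have hsq : ∀ i : Fin n, (((s >>> (i : ℕ)) % 2 : ℕ) : ℤ) ^ 2 = ((s >>> (i : ℕ)) % 2 : ℕ) := by
    intro i
    rcases Nat.mod_two_eq_zero_or_one (s >>> (i : ℕ)) with h | h <;> simp [h]
  rw [H_eq_sub (cast_cutDist s) hb]
  simp only [hsq, Finset.univ_unique, Finset.sum_singleton, one_mul]

lemma cutDist_mem_HYP {n : ℕ} (s : ℕ) :
    (fun p => (cutDist s p.1.1 p.1.2 : ℝ) : DistVec n) ∈ HYP n := by
  intro b hb
  rw [H_cutDist s hb, ← Int.cast_zero, Int.cast_le]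
  linarith [Int.le_self_sq (∑ i : Fin n, b i * ((s >>> (i : ℕ)) % 2 : ℕ))]

/-- The `56` solutions `w` are the vertices of the Gosset polytope `3₂₁`, a Delaunay polytope of the
lattice `E₇`: up to sign and order, `w` is `(3, 3, -1, -1, -1, -1, -1, -1)`. The affine conditions
describe a coset of the lattice, scaled by a factor, and the quadratic one a sphere around `0`. -/
def IsGossetVertex (w : Fin 8 → ℤ) : Prop :=
  ∑ k, w k ^ 2 = 24 ∧ ∑ k, w k = 0 ∧ w 0 % 2 = 1 ∧ ∀ k, (w k - w 0) % 4 = 0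

instance : DecidablePred IsGossetVertex := fun w => by unfold IsGossetVertex; infer_instance

/-- A vector with zero sum whose eight entries are odd and
congruent to each other modulo `4` has squared norm at least `24`. If the entries are `r` modulo `4`
with `r = 1` or `r = -1`, then no entry lies strictly between `-3 * r` and `r`, so that
`(w k - r) * (w k + 3 * r)` is nonnegative; these numbers are then summed up. -/
lemma gosset_bound (w : Fin 8 → ℤ) (h0 : ∑ k, w k = 0) (h2 : w 0 % 2 = 1)
    (h4 : ∀ k, (w k - w 0) % 4 = 0) : 24 ≤ ∑ k, w k ^ 2 := by
  have key : ∀ r : ℤ, (∀ k, (w k - r) % 4 = 0) → r = 1 ∨ r = -1 → 24 ≤ ∑ k, w k ^ 2 := by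
    intro r hr hr'
    have hk : ∀ k, 3 - 2 * r * w k ≤ w k ^ 2 := by
      intro k
      obtain ⟨t, ht⟩ := Int.dvd_of_emod_eq_zero (hr k)
      have hw : w k = 4 * t + r := by linarith
      have ht' : 0 ≤ t * (t + r) := by
        rcases hr' with rfl | rfl
        · rcases le_or_gt 0 t with h | h
          · positivity
          · exact mul_nonneg_of_nonpos_of_nonpos h.le (by omega)
        · rcases le_or_gt t 0 with h | h
          · exact mul_nonneg_of_nonpos_of_nonpos h (by omega)
          · exact mul_nonneg h.le (by omega)
      have hrr : r * r = 1 := by rcases hr' with rfl | rfl <;> rfl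
      rw [hw]
      linear_combination 16 * ht' - 3 * hrr
    have := Finset.sum_le_sum fun k (_ : k ∈ Finset.univ) => hk k
    rw [Finset.sum_sub_distrib, ← Finset.mul_sum, h0] at this
    simpa using this
  by_cases h : w 0 % 4 = 1
  · exact key 1 (fun k => by have := h4 k; omega) (Or.inl rfl)
  · exact key (-1) (fun k => by have := h4 k; omega) (Or.inr rfl)

lemma gosset_mem_HYP {n : ℕ} {v : Fin n → Fin 8 → ℤ} (hv : ∀ i, IsGossetVertex (v i))
    {D : Fin n → Fin n → ℕ} (hD : ∀ i j, (D i j : ℤ) = ∑ k, (v i k - v j k) ^ 2) :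
    (fun p => (D p.1.1 p.1.2 : ℝ) : DistVec n) ∈ HYP n := by
  refine mem_HYP_of_nonneg (fun _ => 1) (fun _ => 0) (-24) v D
    (fun i j => by simp only [hD, one_mul]) (fun i => by simp [(hv i).1]) fun b hb => ?_
  have h := gosset_bound (fun k => ∑ i, b i * v i k) ?_ ?_ fun k => ?_
  · simp only [one_mul, zero_mul, add_zero]
    linarith
  · rw [Finset.sum_comm]
    refine Finset.sum_eq_zero fun i _ => ?_
    rw [← Finset.mul_sum, (hv i).2.1, mul_zero]
  · exact affine_modEq (r := 1) hb fun i => (hv i).2.2.1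
  · have := affine_modEq (r := 0) (m := 4) hb fun i => (hv i).2.2.2 k
    simp only [mul_sub, Finset.sum_sub_distrib] at this
    exact this

/-- The sum of the first six coordinates. -/
def erSum (w : Fin 8 → ℤ) : ℤ := w 0 + w 1 + w 2 + w 3 + w 4 + w 5

/-- A quadratic form of rank seven. It does not change if the same number is added to each of the
first six coordinates. -/
def erQuad (w : Fin 8 → ℤ) : ℤ :=
  6 * (w 0 ^ 2 + w 1 ^ 2 + w 2 ^ 2 + w 3 ^ 2 + w 4 ^ 2 + w 5 ^ 2) + 4 * w 6 ^ 2 + 3 * w 7 ^ 2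
    - erSum w ^ 2

/-- Up to a common translation of the first six coordinates, the `35` solutions `w` are the vertices
of the Erdahl–Rybnikov polytope, a Delaunay polytope in dimension `7`. The two congruences describe
an affine lattice, and the equation a sphere. -/
def IsERVertex (w : Fin 8 → ℤ) : Prop :=
  erQuad w - 9 * w 6 = 3 ∧ (w 6 - 2 * erSum w) % 3 = 0 ∧ (w 7 - w 6 - erSum w) % 2 = 1

instance : DecidablePred IsERVertex := fun w => by unfold IsERVertex; infer_instance

/-- The form `erQuad` is diagonal in the eight coordinates together with `erSum`. -/
lemma erQuad_eq (w : Fin 8 → ℤ) :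
    erQuad w = ∑ k : Fin 9, (![6, 6, 6, 6, 6, 6, 4, 3, -1] : Fin 9 → ℤ) k *
      (Fin.snoc w (erSum w) : Fin 9 → ℤ) k ^ 2 := by
  simp [erQuad, Fin.sum_univ_castSucc, Fin.snoc]
  ring

lemma erQuad_nonneg (w : Fin 8 → ℤ) : 0 ≤ erQuad w := by
  have h := sq_sum_le_card_mul_sum_sq (s := Finset.univ)
    (f := fun k : Fin 6 => w (k.castLE (by omega)))
  simp only [Fin.sum_univ_six, Finset.card_univ, Fintype.card_fin] at h
  have h' : erSum w ^ 2 ≤ 6 * (w 0 ^ 2 + w 1 ^ 2 + w 2 ^ 2 + w 3 ^ 2 + w 4 ^ 2 + w 5 ^ 2) := h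
  unfold erQuad
  nlinarith [sq_nonneg (w 6), sq_nonneg (w 7)]

/-- No point of the affine lattice lies inside the sphere. With `r` the residue of `erSum w` modulo
`6`, the first six coordinates contribute at least `r * (6 - r)` to the form, which is attained when
they differ by at most `1`. What remains is a finite number of cases for `r` and `w 6`. -/
lemma er_bound (w : Fin 8 → ℤ) (h3 : (w 6 - 2 * erSum w) % 3 = 0)
    (h2 : (w 7 - w 6 - erSum w) % 2 = 1) : 3 ≤ erQuad w - 9 * w 6 := by
  obtain ⟨k, r, hr0, hr6, hkr⟩ : ∃ k r : ℤ, 0 ≤ r ∧ r < 6 ∧ erSum w = 6 * k + r :=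
    ⟨erSum w / 6, erSum w % 6, by omega, by omega, by omega⟩
  -- No integer lies strictly between `k` and `k + 1`.
  have hk : ∀ x : ℤ, (2 * k + 1) * x - k * (k + 1) ≤ x ^ 2 := by
    intro x
    have : 0 ≤ (x - k) * (x - k - 1) := by
      rcases le_or_gt x k with h | h
      · exact mul_nonneg_of_nonpos_of_nonpos (by omega) (by omega)
      · exact mul_nonneg (by omega) (by omega)
    linear_combination this
  have hA : r * (6 - r) ≤
      6 * (w 0 ^ 2 + w 1 ^ 2 + w 2 ^ 2 + w 3 ^ 2 + w 4 ^ 2 + w 5 ^ 2) - erSum w ^ 2 := by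
    have e : erSum w ^ 2 = (6 * k + r) ^ 2 := by rw [hkr]
    have e' : (2 * k + 1) * (w 0 + w 1 + w 2 + w 3 + w 4 + w 5) = (2 * k + 1) * (6 * k + r) := by
      rw [← hkr, erSum]
    linear_combination 6 * (hk (w 0) + hk (w 1) + hk (w 2) + hk (w 3) + hk (w 4) + hk (w 5))
      + e - 6 * e'
  have hQ : erQuad w - 9 * w 6 =
      6 * (w 0 ^ 2 + w 1 ^ 2 + w 2 ^ 2 + w 3 ^ 2 + w 4 ^ 2 + w 5 ^ 2) - erSum w ^ 2 +
        (4 * w 6 ^ 2 - 9 * w 6) + 3 * w 7 ^ 2 := by unfold erQuad; ring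
  rw [hQ]
  generalize 6 * (w 0 ^ 2 + w 1 ^ 2 + w 2 ^ 2 + w 3 ^ 2 + w 4 ^ 2 + w 5 ^ 2) - erSum w ^ 2 = A
    at hA ⊢
  have hy : 0 ≤ w 7 ^ 2 := sq_nonneg _
  have hy1 : w 7 % 2 = 1 → 1 ≤ w 7 ^ 2 := fun h => by
    have : w 7 ≠ 0 := by rintro h0; rw [h0] at h; norm_num at h
    have := sq_pos_of_ne_zero this
    omega
  generalize w 7 ^ 2 = Y at hy hy1 ⊢
  generalize w 6 = a at *
  rcases lt_or_ge a 0 with ha | ha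
  · have : 13 ≤ 4 * a ^ 2 - 9 * a := by nlinarith
    interval_cases r <;> omega
  rcases le_or_gt 3 a with ha' | ha'
  · have : 9 ≤ 4 * a ^ 2 - 9 * a := by nlinarith
    interval_cases r <;> omega
  interval_cases a <;> interval_cases r <;> omega

lemma er_mem_HYP {n : ℕ} {v : Fin n → Fin 8 → ℤ} (hv : ∀ i, IsERVertex (v i))
    {D : Fin n → Fin n → ℕ} (hD : ∀ i j, (D i j : ℤ) = erQuad fun k => v i k - v j k) :
    (fun p => (D p.1.1 p.1.2 : ℝ) : DistVec n) ∈ HYP n := by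
  have hlin : ∀ w : Fin 8 → ℤ, ∑ k : Fin 9, (![0, 0, 0, 0, 0, 0, -9, 0, 0] : Fin 9 → ℤ) k *
      (Fin.snoc w (erSum w) : Fin 9 → ℤ) k = -9 * w 6 := by
    intro w
    simp [Fin.sum_univ_castSucc, Fin.snoc]
  have hsum : ∀ b : Fin n → ℤ, ∀ k : Fin 9,
      ∑ i, b i * (Fin.snoc (v i) (erSum (v i)) : Fin 9 → ℤ) k =
        (Fin.snoc (fun k => ∑ i, b i * v i k) (erSum fun k => ∑ i, b i * v i k) : Fin 9 → ℤ) k := by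
    intro b k
    refine Fin.lastCases ?_ (fun k => ?_) k
    · simp only [Fin.snoc_last, erSum, mul_add, Finset.sum_add_distrib]
    · simp only [Fin.snoc_castSucc]
  refine mem_HYP_of_nonneg ![6, 6, 6, 6, 6, 6, 4, 3, -1] ![0, 0, 0, 0, 0, 0, -9, 0, 0] (-3)
    (fun i => Fin.snoc (v i) (erSum (v i))) D (fun i j => ?_) (fun i => ?_) fun b hb => ?_
  · rw [hD, erQuad_eq]
    refine Finset.sum_congr rfl fun k _ => ?_
    congr 2
    refine Fin.lastCases ?_ (fun k => ?_) k
    · simp only [Fin.snoc_last, erSum]; ring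
    · simp only [Fin.snoc_castSucc]
  · rw [Finset.sum_add_distrib, ← erQuad_eq, hlin]
    linarith [(hv i).1]
  · simp only [hsum]
    rw [Finset.sum_add_distrib, ← erQuad_eq, hlin]
    have := er_bound (fun k => ∑ i, b i * v i k) ?_ ?_
    · linarith
    · have := affine_modEq (r := 0) (m := 3) hb fun i => (hv i).2.1
      simp only [erSum, mul_sub, mul_add, Finset.sum_sub_distrib, Finset.sum_add_distrib,
        mul_left_comm _ (2 : ℤ), ← Finset.mul_sum] at this ⊢
      exact this
    · have := affine_modEq (r := 1) (m := 2) hb fun i => (hv i).2.2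
      simp only [erSum, mul_sub, mul_add, Finset.sum_sub_distrib, Finset.sum_add_distrib] at this ⊢
      exact this

/-- The `k`-th digit in base `4` of the `i`-th block of eight such digits of `c`. -/
def digit (c i k : ℕ) : ℕ := c >>> (16 * i + 2 * k) % 4

/-- The `i`-th of the candidates for Gosset vertices encoded by `c`: the digits `0`, `1`, `2`, `3`
stand for the coordinates `-3`, `-1`, `1`, `3`. -/
def gossetPoint (c i : ℕ) (k : Fin 8) : ℤ := 2 * (digit c i k : ℤ) - 3

/-- The `i`-th of the candidates for Erdahl–Rybnikov vertices encoded by `c`: the digits `0`, `1`,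
`2`, `3` stand for the coordinates `-1`, `0`, `1`, `2`. -/
def erPoint (c i : ℕ) (k : Fin 8) : ℤ := (digit c i k : ℤ) - 1

/-- The square of the difference of the `k`-th digits of the points `i` and `j`. It is computed in
`ℕ`, as are the distances below, so that the kernel evaluates it quickly. -/
def sqDiff (c i j k : ℕ) : ℕ :=
  Nat.dist (digit c i k) (digit c j k) * Nat.dist (digit c i k) (digit c j k)

lemma cast_dist_mul_dist (a b : ℕ) : ((Nat.dist a b * Nat.dist a b : ℕ) : ℤ) = (a - b) ^ 2 := by
  rcases le_total a b with h | h
  · rw [Nat.dist_eq_sub_of_le h]; push_cast [h]; ring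
  · rw [Nat.dist_eq_sub_of_le_right h]; push_cast [h]; ring

/-- The squared distance of the points `i` and `j` given by `gossetPoint`. -/
def gossetDist (c i j : ℕ) : ℕ :=
  4 * (sqDiff c i j 0 + sqDiff c i j 1 + sqDiff c i j 2 + sqDiff c i j 3 + sqDiff c i j 4 +
    sqDiff c i j 5 + sqDiff c i j 6 + sqDiff c i j 7)

lemma cast_gossetDist (c i j : ℕ) :
    (gossetDist c i j : ℤ) = ∑ k, (gossetPoint c i k - gossetPoint c j k) ^ 2 := by
  simp only [gossetDist, sqDiff, Nat.cast_mul 4, Nat.cast_add, cast_dist_mul_dist, gossetPoint,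
    Fin.sum_univ_eight]
  simp only [Fin.isValue, Fin.coe_ofNat_eq_mod, Nat.reduceMod]
  push_cast
  ring

/-- The sum of the first six digits of the point `i`. -/
def digitSum (c i : ℕ) : ℕ :=
  digit c i 0 + digit c i 1 + digit c i 2 + digit c i 3 + digit c i 4 + digit c i 5

/-- The squared distance of the points `i` and `j` given by `erPoint`, in the form `erQuad`. -/
def erDist (c i j : ℕ) : ℕ :=
  6 * (sqDiff c i j 0 + sqDiff c i j 1 + sqDiff c i j 2 + sqDiff c i j 3 + sqDiff c i j 4 +
    sqDiff c i j 5) + 4 * sqDiff c i j 6 + 3 * sqDiff c i j 7 -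
    Nat.dist (digitSum c i) (digitSum c j) * Nat.dist (digitSum c i) (digitSum c j)

lemma cast_erDist (c i j : ℕ) :
    (erDist c i j : ℤ) = erQuad fun k => erPoint c i k - erPoint c j k := by
  have h : erQuad (fun k => erPoint c i k - erPoint c j k) =
      ((6 * (sqDiff c i j 0 + sqDiff c i j 1 + sqDiff c i j 2 + sqDiff c i j 3 + sqDiff c i j 4 +
        sqDiff c i j 5) + 4 * sqDiff c i j 6 + 3 * sqDiff c i j 7 : ℕ) : ℤ) -
      ((Nat.dist (digitSum c i) (digitSum c j) *
        Nat.dist (digitSum c i) (digitSum c j) : ℕ) : ℤ) := by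
    simp only [sqDiff, Nat.cast_mul 6, Nat.cast_mul 4, Nat.cast_mul 3, Nat.cast_add,
      cast_dist_mul_dist, erPoint, erQuad, erSum, digitSum]
    simp only [Fin.isValue, Fin.coe_ofNat_eq_mod, Nat.reduceMod]
    push_cast
    ring
  have h0 := erQuad_nonneg fun k => erPoint c i k - erPoint c j k
  rw [h] at h0 ⊢
  rw [erDist, Nat.cast_sub (by omega)]

/-- The distances with the code `c`. The residue of `c` modulo `3` tells the family, and `c / 3`
encodes the two sides of a cut by its binary digits, or eight points of a lattice by its digits in
base `4`. -/
def rayDist (c i j : ℕ) : ℕ :=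
  match c % 3 with
  | 0 => cutDist (c / 3) i j
  | 1 => gossetDist (c / 3) i j
  | _ => erDist (c / 3) i j

/-- The points encoded by `c` lie on the sphere of the family to which `c` belongs. -/
def IsRay (c : ℕ) : Prop :=
  match c % 3 with
  | 0 => True
  | 1 => ∀ i : Fin 8, IsGossetVertex (gossetPoint (c / 3) i)
  | _ => ∀ i : Fin 8, IsERVertex (erPoint (c / 3) i)

instance : DecidablePred IsRay := fun c => by unfold IsRay; split <;> infer_instance

lemma rayDist_mem_HYP {c : ℕ} (hc : IsRay c) :
    (fun p => (rayDist c p.1.1 p.1.2 : ℝ) : DistVec 8) ∈ HYP 8 := by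
  unfold IsRay at hc
  unfold rayDist
  split at hc
  · exact cutDist_mem_HYP _
  · exact gosset_mem_HYP (D := fun i j => gossetDist (c / 3) i j) hc
      fun i j => cast_gossetDist _ _ _
  · exact er_mem_HYP (D := fun i j => erDist (c / 3) i j) hc fun i j => cast_erDist _ _ _

lemma digit_lt (c i k : ℕ) : digit c i k < 4 := Nat.mod_lt _ (by norm_num)

lemma sqDiff_le (c i j k : ℕ) : sqDiff c i j k ≤ 9 := by
  have h : Nat.dist (digit c i k) (digit c j k) ≤ 3 := by
    have := digit_lt c i k
    have := digit_lt c j k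
    unfold Nat.dist
    omega
  exact Nat.mul_le_mul h h

/-- A crude bound: the squares of the digit differences are at most `9`, and their coefficients have
sum `32` in one lattice and at most `43` in the other. -/
lemma rayDist_le (c i j : ℕ) : rayDist c i j ≤ 400 := by
  have h := sqDiff_le (c / 3) i j
  have h0 := h 0
  have h1 := h 1
  have h2 := h 2
  have h3 := h 3
  have h4 := h 4
  have h5 := h 5
  have h6 := h 6
  have h7 := h 7
  unfold rayDist
  split
  · unfold cutDist; omega
  · unfold gossetDist; omega
  · refine (Nat.sub_le _ _).trans ?_
    omega

/-! ### Gaussian elimination modulo a prime on packed rows -/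

/-- Gaussian elimination modulo `p` without a choice of pivots, as a test of the invertibility of an
`n × n` matrix. Each row is a single number, with the entries as its digits in base `B` and the
first entry as the lowest digit. A multiple of the first row makes the first entry of another row
divisible by `p`, and the division by `B` deletes that entry. The digits are not reduced modulo `p`,
so `B` has to be so large that no carries occur. The power is the inverse of the pivot, by Fermat's
little theorem. -/
def eliminate (p B : ℕ) : ℕ → List ℕ → Bool
  | 0, _ => true
  | _ + 1, [] => false
  | n + 1, r :: rs =>
    r % B % p != 0 && eliminate p B n
      (rs.map fun s => (s + (p - s % B % p) * (r % B % p) ^ (p - 2) % p * r) / B)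

/-- The dot product of a row of natural numbers with a vector over `ZMod p`. -/
def dot {p : ℕ} (x : List ℕ) (y : List (ZMod p)) : ZMod p :=
  (List.zipWith (fun (a : ℕ) c => (a : ZMod p) * c) x y).sum

lemma dot_zipWith {p : ℕ} (c : ℕ) : ∀ (s r : List ℕ) (y : List (ZMod p)),
    s.length = y.length → r.length = y.length →
      dot (List.zipWith (fun u v => u + c * v) s r) y = dot s y + c * dot r y
  | _, _, [], _, _ => by simp [dot]
  | [], _, _ :: _, hs, _ => by simp at hs
  | _ :: _, [], _ :: _, _, hr => by simp at hr
  | u :: s, v :: r, a :: y, hs, hr => by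
    have ih := dot_zipWith c s r y (by simpa using hs) (by simpa using hr)
    simp only [dot, List.zipWith_cons_cons, List.sum_cons] at ih ⊢
    rw [ih]; push_cast; ring

lemma ofDigits_zipWith (B c : ℕ) : ∀ s r : List ℕ, s.length = r.length →
    Nat.ofDigits B (List.zipWith (fun u v => u + c * v) s r) =
      Nat.ofDigits B s + c * Nat.ofDigits B r
  | [], [], _ => by simp
  | u :: s, v :: r, h => by
    rw [List.zipWith_cons_cons, Nat.ofDigits_cons, Nat.ofDigits_cons, Nat.ofDigits_cons,
      ofDigits_zipWith B c s r (by simpa using h)]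
    ring

lemma le_of_mem_zipWith {β c : ℕ} : ∀ {s r : List ℕ}, (∀ x ∈ s, x ≤ β) → (∀ x ∈ r, x ≤ β) →
    ∀ x ∈ List.zipWith (fun u v => u + c * v) s r, x ≤ (1 + c) * β
  | [], _, _, _, x, hx => by simp at hx
  | _ :: _, [], _, _, x, hx => by simp at hx
  | u :: s, v :: r, hs, hr, x, hx => by
    rw [List.zipWith_cons_cons, List.mem_cons] at hx
    rcases hx with rfl | hx
    · have h1 := hs u (by simp)
      have h2 := Nat.mul_le_mul_left c (hr v (by simp))
      linarith
    · exact le_of_mem_zipWith (fun y hy => hs y (by simp [hy]))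
        (fun y hy => hr y (by simp [hy])) x hx

lemma cast_add_mul_eq_zero {p : ℕ} [Fact p.Prime] {x z B : ℕ} (hx : x % B % p ≠ 0)
    (hxB : x < B) (hzB : z < B) :
    ((z + (p - z % B % p) * (x % B % p) ^ (p - 2) % p * x : ℕ) : ZMod p) = 0 := by
  rw [Nat.mod_eq_of_lt hxB] at hx ⊢
  rw [Nat.mod_eq_of_lt hzB]
  have hp := (Fact.out : p.Prime)
  have hx0 : (x : ZMod p) ≠ 0 := by
    rw [Ne, ZMod.natCast_eq_zero_iff]
    exact fun h => hx (Nat.mod_eq_zero_of_dvd h)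
  have hpow : (x : ZMod p) ^ (p - 2) * x = 1 := by
    rw [← pow_succ, show p - 2 + 1 = p - 1 by have := hp.two_le; omega]
    exact ZMod.pow_card_sub_one_eq_one hx0
  have hneg : ((p - z % p : ℕ) : ZMod p) = -z := by
    rw [Nat.cast_sub (Nat.mod_lt z hp.pos).le, ZMod.natCast_self, ZMod.natCast_mod, zero_sub]
  simp only [Nat.cast_add, ZMod.natCast_mod, Nat.cast_mul, Nat.cast_pow]
  rw [hneg, mul_assoc, hpow]
  ring

/-- If the elimination succeeds, then the matrix has a trivial kernel modulo `p`. In each step the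
bound `β` for the entries grows by a factor `p` at most, so `β * p ^ n < B` excludes carries. -/
theorem eq_zero_of_eliminate {p B : ℕ} [Fact p.Prime] : ∀ (n β : ℕ) (rows : List (List ℕ)),
    eliminate p B n (rows.map (Nat.ofDigits B)) = true →
    (∀ r ∈ rows, r.length = n ∧ ∀ x ∈ r, x ≤ β) → β * p ^ n < B →
    ∀ y : List (ZMod p), y.length = n → (∀ r ∈ rows, dot r y = 0) → ∀ a ∈ y, a = 0
  | 0, _, _, _, _, _, y, hy, _ => by
    rw [List.length_eq_zero_iff] at hy
    simp [hy]
  | n + 1, _, [], h, _, _, _, _, _ => by simp [eliminate] at h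
  | n + 1, β, [] :: rs, _, hr, _, _, _, _ => by simpa using (hr [] (by simp)).1
  | n + 1, β, (x :: r) :: rs, h, hr, hB, [], hy, _ => by simp at hy
  | n + 1, β, (x :: r) :: rs, h, hr, hB, a :: y, hy, hdot => by
    have hp := (Fact.out : p.Prime)
    have hβp : β * p < B := lt_of_le_of_lt
      (Nat.mul_le_mul_left β (Nat.le_self_pow (Nat.succ_ne_zero n) p)) hB
    have hβ : β < B := lt_of_le_of_lt (Nat.le_mul_of_pos_right β hp.pos) hβp
    have hhead : ∀ (z : ℕ) (s : List ℕ), z ≤ β → Nat.ofDigits B (z :: s) % B = z := by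
      intro z s hz
      rw [Nat.ofDigits_cons, Nat.add_mul_mod_self_left, Nat.mod_eq_of_lt (hz.trans_lt hβ)]
    have hxr := hr (x :: r) (by simp)
    have hxβ : x ≤ β := hxr.2 x (by simp)
    have hrl : r.length = n := by simpa using hxr.1
    have hyl : y.length = n := by simpa using hy
    rw [List.map_cons, eliminate, Bool.and_eq_true, bne_iff_ne, hhead x r hxβ] at h
    obtain ⟨hx, h⟩ := h
    have hx' : x % B % p ≠ 0 := by rwa [Nat.mod_eq_of_lt (hxβ.trans_lt hβ)]
    let mult : ℕ → ℕ := fun z => (p - z % B % p) * (x % B % p) ^ (p - 2) % p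
    let step : List ℕ → List ℕ := fun s =>
      List.zipWith (fun u v => u + mult (s.headD 0) * v) s.tail r
    have hmult : ∀ z, 1 + mult z ≤ p := fun z => by
      have : mult z < p := Nat.mod_lt _ hp.pos
      omega
    have hstep : (rs.map (Nat.ofDigits B)).map (fun s =>
        (s + (p - s % B % p) * (x % p) ^ (p - 2) % p * Nat.ofDigits B (x :: r)) / B) =
        (rs.map step).map (Nat.ofDigits B) := by
      rw [List.map_map, List.map_map]
      refine List.map_congr_left fun s hs => ?_
      have hs' := hr s (by simp [hs])
      match s, hs' with
      | [], hs' => simp at hs'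
      | z :: s, hs' =>
        have hzβ : z ≤ β := hs'.2 z (by simp)
        simp only [Function.comp_apply, step, List.headD_cons, List.tail_cons, hhead z s hzβ]
        rw [ofDigits_zipWith B _ s r (by rw [hrl]; simpa using hs'.1), Nat.ofDigits_cons,
          Nat.ofDigits_cons]
        have hlt : z + mult z * x < B := by
          have h1 := Nat.mul_le_mul_right β (hmult z)
          have h2 := Nat.mul_le_mul_left (mult z) hxβ
          nlinarith
        have hmz : (p - z % p) * (x % p) ^ (p - 2) % p = mult z := by
          simp only [mult, Nat.mod_eq_of_lt (hxβ.trans_lt hβ), Nat.mod_eq_of_lt (hzβ.trans_lt hβ)]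
        rw [hmz, show z + B * Nat.ofDigits B s + mult z * (x + B * Nat.ofDigits B r) =
          z + mult z * x + B * (Nat.ofDigits B s + mult z * Nat.ofDigits B r) by ring,
          Nat.add_mul_div_left _ _ (Nat.zero_lt_of_lt hβ), Nat.div_eq_of_lt hlt, zero_add]
    rw [hstep] at h
    have hdr : (x : ZMod p) * a + dot r y = 0 := by simpa [dot] using hdot (x :: r) (by simp)
    have ih := eq_zero_of_eliminate n (p * β) (rs.map step) h ?_ ?_ y hyl ?_
    · have hy0 : dot r y = 0 := by
        refine List.sum_eq_zero fun t ht => ?_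
        obtain ⟨i, hi, rfl⟩ := List.getElem_of_mem ht
        rw [List.getElem_zipWith, ih _ (List.getElem_mem _), mul_zero]
      rw [hy0, add_zero] at hdr
      have hx0 : (x : ZMod p) ≠ 0 := by
        rw [Ne, ZMod.natCast_eq_zero_iff]
        exact fun h => hx (Nat.mod_eq_zero_of_dvd h)
      intro t ht
      rcases List.mem_cons.1 ht with rfl | ht
      · exact (mul_eq_zero.1 hdr).resolve_left hx0
      · exact ih t ht
    · intro q hq
      obtain ⟨s, hs, rfl⟩ := List.mem_map.1 hq
      have hs' := hr s (by simp [hs])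
      refine ⟨by simp [step, hs'.1, hrl], fun t ht => ?_⟩
      refine (le_of_mem_zipWith (fun u hu => hs'.2 u (List.mem_of_mem_tail hu))
        (fun u hu => hxr.2 u (by simp [hu])) t ht).trans ?_
      exact Nat.mul_le_mul_right β (hmult _)
    · calc p * β * p ^ n = β * p ^ (n + 1) := by ring
        _ < B := hB
    · intro q hq
      obtain ⟨s, hs, rfl⟩ := List.mem_map.1 hq
      have hs' := hr s (by simp [hs])
      have hds := hdot s (by simp [hs])
      match s, hs', hds with
      | [], hs', _ => simp at hs'
      | z :: s, hs', hds =>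
        have hzβ : z ≤ β := hs'.2 z (by simp)
        have hds' : (z : ZMod p) * a + dot s y = 0 := by simpa [dot] using hds
        simp only [step, List.headD_cons, List.tail_cons]
        rw [dot_zipWith _ s r y (by rw [hyl]; simpa using hs'.1) (by rw [hrl, hyl])]
        have hc := cast_add_mul_eq_zero (p := p) hx' (hxβ.trans_lt hβ) (hzβ.trans_lt hβ)
        change ((z + mult z * x : ℕ) : ZMod p) = 0 at hc
        push_cast at hc
        linear_combination hds' + (mult z : ZMod p) * hdr - a * hc

/-! ### Certificates for facets -/

/-- The pairs `(i, j)` with `i < j < 8`, in lexicographic order. -/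
def pairs : List (ℕ × ℕ) :=
  [(0, 1), (0, 2), (0, 3), (0, 4), (0, 5), (0, 6), (0, 7), (1, 2), (1, 3), (1, 4), (1, 5), (1, 6),
   (1, 7), (2, 3), (2, 4), (2, 5), (2, 6), (2, 7), (3, 4), (3, 5), (3, 6), (3, 7), (4, 5), (4, 6),
   (4, 7), (5, 6), (5, 7), (6, 7)]

lemma sum_pairs {M : Type*} [AddCommMonoid M] (f : ℕ → ℕ → M) :
    ∑ p : {p : Fin 8 × Fin 8 // p.1 < p.2}, f p.1.1 p.1.2 = (pairs.map fun q => f q.1 q.2).sum := by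
  have h : ∑ p : {p : Fin 8 × Fin 8 // p.1 < p.2}, f p.1.1 p.1.2 =
      ∑ i : Fin 8, ∑ j : Fin 8, if i < j then f i j else 0 := by
    rw [← Fintype.sum_prod_type' fun i j : Fin 8 => if i < j then f i j else 0,
      ← Finset.sum_filter]
    exact (Finset.sum_subtype _ (by simp) fun p : Fin 8 × Fin 8 => f p.1 p.2).symm
  rw [h]
  simp [Fin.sum_univ_eight, pairs]
  abel

/-- A list as a vector, with `0` for the entries beyond the end of the list. -/
def vec (l : List ℤ) : Fin 8 → ℤ := fun i => l.getD i 0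

/-- The distance vector on eight points with the code `c`. -/
def ray (c : ℕ) : DistVec 8 := fun p => (rayDist c p.1.1 p.1.2 : ℝ)

/-- The integer `H b d` for `b = vec l` and `d = ray c`. -/
def value (l : List ℤ) (c : ℕ) : ℤ :=
  (pairs.map fun q => l.getD q.1 0 * l.getD q.2 0 * (rayDist c q.1 q.2 : ℤ)).sum

lemma H_ray (l : List ℤ) (c : ℕ) : H (vec l) (ray c) = value l c := by
  rw [value, ← sum_pairs fun i j => l.getD i 0 * l.getD j 0 * (rayDist c i j : ℤ)]
  push_cast
  rfl

/-- The sum of the entries of `l` at the positions of the binary digits `1` of `s`. -/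
def cutSum : List ℤ → ℕ → ℤ
  | [], _ => 0
  | a :: l, s => a * (s % 2 : ℕ) + cutSum l (s / 2)

lemma cutSum_eq_sum : ∀ (l : List ℤ) (s : ℕ),
    cutSum l s = ∑ i : Fin l.length, l[i] * ((s >>> (i : ℕ)) % 2 : ℕ)
  | [], _ => rfl
  | a :: l, s => by
    rw [cutSum, cutSum_eq_sum l]
    refine Eq.trans ?_ (Fin.sum_univ_succ _).symm
    simp only [Fin.val_succ, Nat.shiftRight_succ_inside]
    rfl

/-- The ray with the code `c` satisfies the inequality of `l` with equality. For a cut this is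
decided by the sum of the entries of `l` on one side, which has to be `0` or `1`. -/
def IsTight (l : List ℤ) (c : ℕ) : Prop :=
  match c % 3 with
  | 0 => cutSum l (c / 3) = 0 ∨ cutSum l (c / 3) = 1
  | _ => value l c = 0

instance (l : List ℤ) : DecidablePred (IsTight l) := fun c => by
  unfold IsTight; split <;> infer_instance

lemma IsTight.H_eq_zero {l : List ℤ} {c : ℕ} (hlen : l.length = 8) (hl : ∑ i, vec l i = 1)
    (h : IsTight l c) : H (vec l) (ray c) = 0 := by
  unfold IsTight at h
  split at h
  · rename_i h0
    have hray : ray c = fun p => (cutDist (c / 3) p.1.1 p.1.2 : ℝ) := by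
      funext p
      simp [ray, rayDist, h0]
    have hsum : cutSum l (c / 3) = ∑ i : Fin 8, vec l i * ((c / 3) >>> (i : ℕ) % 2 : ℕ) := by
      rw [cutSum_eq_sum, ← Fin.sum_congr' _ hlen]
      simp [vec]
    rw [hray, H_cutDist _ hl, ← hsum, Int.cast_eq_zero]
    rcases h with h | h <;> rw [h] <;> norm_num
  · rw [H_ray, h, Int.cast_zero]

/-- The entries of `ray c`, in the order of `pairs`. -/
def row (c : ℕ) : List ℕ := pairs.map fun q => rayDist c q.1 q.2

/-- The test that the inequality of `l` defines a facet: each of the `27` codes `cs` is that of a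
hypermetric with equality, and these hypermetrics, together with the cut that separates the first
point from the others (its code is `3`), are linearly independent modulo `31`. -/
def check (l : List ℤ) (cs : List ℕ) : Bool :=
  l.length == 8 && decide (∑ i, vec l i = 1) && cs.length == 27 &&
  cs.all (fun c => decide (IsRay c) && decide (IsTight l c)) &&
  value l 3 != 0 &&
  eliminate 31 (2 ^ 160) 28 ((cs ++ [3]).map fun c => Nat.ofDigits (2 ^ 160) (row c))

lemma isRay_three : IsRay 3 := by decide

lemma pairs_lt : ∀ k : Fin 28, (pairs[k]).1 < (pairs[k]).2 ∧ (pairs[k]).2 < 8 := by decide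

instance : Fact (Nat.Prime 31) := ⟨by norm_num⟩

/-- The rays with the codes `cs`, followed by the cut of the first point, are linearly independent
if the rows of their entries are linearly independent modulo `31`. The bound for `B` comes from
`rayDist_le`. -/
lemma linearIndependent_ray {B : ℕ} (hB : 400 * 31 ^ 28 < B) {cs : List ℕ} (hlen : cs.length = 27)
    (h : eliminate 31 B 28 ((cs ++ [3]).map fun c => Nat.ofDigits B (row c)) = true) :
    LinearIndependent ℝ fun k : Fin 28 => ray (cs.getD k 3) := by
  let A : Matrix (Fin 28) (Fin 28) ℤ := fun k m =>
    (rayDist (cs.getD k 3) (pairs[m]).1 (pairs[m]).2 : ℤ)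
  have h' : eliminate 31 B 28 (((cs ++ [3]).map row).map (Nat.ofDigits B)) = true := by
    rw [List.map_map]; exact h
  have hrow' : ∀ r ∈ (cs ++ [3]).map row, r.length = 28 ∧ ∀ x ∈ r, x ≤ 400 := by
    intro r hr
    obtain ⟨c, hc, rfl⟩ := List.mem_map.1 hr
    refine ⟨by rw [row, List.length_map]; rfl, ?_⟩
    intro x hx
    obtain ⟨q, -, rfl⟩ := List.mem_map.1 hx
    exact rayDist_le _ _ _
  have hdot : ∀ c (v : Fin 28 → ZMod 31), dot (row c) (List.ofFn v) =
      ∑ m : Fin 28, (rayDist c (pairs[m]).1 (pairs[m]).2 : ZMod 31) * v m := by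
    intro c v
    have : row c = List.ofFn fun m : Fin 28 => rayDist c (pairs[m]).1 (pairs[m]).2 := by
      rw [row]
      exact List.ext_getElem (by simp [pairs]) fun i hi hi' => by
        rw [List.getElem_map, List.getElem_ofFn]; rfl
    rw [dot, this, ← List.sum_ofFn]
    congr 1
  have hA : A.det ≠ 0 := by
    intro hdet
    have hdet' : (A.map (Int.castRingHom (ZMod 31))).det = 0 := by
      rw [← RingHom.mapMatrix_apply, ← RingHom.map_det, hdet, map_zero]
    obtain ⟨v, hv, hAv⟩ := Matrix.exists_mulVec_eq_zero_iff.2 hdet'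
    refine hv (funext fun i => ?_)
    refine eq_zero_of_eliminate 28 400 _ h' hrow' hB (List.ofFn v) List.length_ofFn ?_ _
      (List.mem_ofFn.2 ⟨i, rfl⟩)
    intro r hr
    obtain ⟨c, hc, rfl⟩ := List.mem_map.1 hr
    obtain ⟨k, hk⟩ : ∃ k : Fin 28, cs.getD k 3 = c := by
      rcases List.mem_append.1 hc with hc | hc
      · obtain ⟨k, hk, rfl⟩ := List.getElem_of_mem hc
        exact ⟨⟨k, by omega⟩, by simp [hk]⟩
      · exact ⟨27, by rw [List.mem_singleton.1 hc]; simp [hlen]⟩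
    have := congrFun hAv k
    rw [hdot, ← hk]
    have hmap : A.map (Int.castRingHom (ZMod 31)) = Matrix.of fun k m : Fin 28 =>
        (rayDist (cs.getD k 3) (pairs[m]).1 (pairs[m]).2 : ZMod 31) := by
      ext k m
      exact Int.cast_natCast _
    rw [hmap] at this
    exact this
  let L : DistVec 8 →ₗ[ℝ] Fin 28 → ℝ :=
    LinearMap.pi fun m => LinearMap.proj
      ⟨(⟨(pairs[m]).1, (pairs_lt m).1.trans (pairs_lt m).2⟩, ⟨(pairs[m]).2, (pairs_lt m).2⟩),
        (pairs_lt m).1⟩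
  apply LinearIndependent.of_comp L
  refine Matrix.linearIndependent_rows_of_det_ne_zero (A := A.map (Int.castRingHom ℝ)) ?_
  rw [← RingHom.mapMatrix_apply, ← RingHom.map_det]
  simpa using hA

lemma finrank_distVec : Module.finrank ℝ (DistVec 8) = 28 := by
  rw [Module.finrank_fintype_fun_eq_card]
  decide

lemma hasTightBasis_of_check {l : List ℤ} {cs : List ℕ} (h : check l cs = true) :
    HasTightBasis (vec l) := by
  simp only [check, Bool.and_eq_true, decide_eq_true_eq, beq_iff_eq, bne_iff_ne,
    List.all_eq_true] at h
  obtain ⟨⟨⟨⟨⟨hl8, hl⟩, hlen⟩, hcs⟩, h3⟩, hel⟩ := h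
  have hmem : ∀ k : Fin 27, cs.getD k 3 ∈ cs := fun k => by
    have hk : (k : ℕ) < cs.length := by omega
    rw [List.getD_eq_getElem _ _ hk]
    exact List.getElem_mem hk
  have hlast : cs.getD (Fin.last 27 : Fin 28) 3 = 3 := by simp [hlen]
  refine ⟨hl, 27, fun k => ray (cs.getD k 3), finrank_distVec.symm,
    linearIndependent_ray (by norm_num) hlen hel, ?_, fun k => ?_, ?_⟩
  · refine Fin.lastCases ?_ fun k => ?_
    · change ray (cs.getD (Fin.last 27 : Fin 28) 3) ∈ HYP 8
      rw [hlast]; exact rayDist_mem_HYP isRay_three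
    · exact rayDist_mem_HYP (hcs _ (hmem k)).1
  · change H (vec l) (ray (cs.getD k 3)) = 0
    exact (hcs _ (hmem k)).2.H_eq_zero hl8 hl
  · change H (vec l) (ray (cs.getD (Fin.last 27 : Fin 28) 3)) ≠ 0
    rw [hlast, H_ray]
    exact_mod_cast h3

/-- For `86` facets in distinct orbits, the coefficients of the inequality in nondecreasing order and
the codes of `27` hypermetrics that span it. The order of the codes is such that
elimination modulo `31` meets no pivot `0`. The list is composed of short ones because a long list
literal is elaborated slowly, and it is irreducible so that unification never unfolds it. -/
@[irreducible] def certificates : List (List ℤ × List ℕ) := List.flatten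
 [[([-5, -4, 1, 1, 1, 2, 2, 3], [138, 12, 24, 48, 582, 294, 234, 174, 162, 186,
    148629157874913050989403567387275181060, 148626252701751916309857186931461078020,
    405149406179367198438768988203001114577, 306, 318, 270, 450, 342, 438, 258, 462, 414, 486,
    426, 402, 342402771585834007837705868521557262366, 282]),
   ([-5, -3, -1, 1, 1, 2, 2, 4], [126, 36, 24, 48, 108, 204, 450, 186, 150, 174, 222, 294,
    468138473785753719208132142733508686065, 60, 84, 282, 306, 390, 330, 246, 426, 354, 270, 402,
    420047729291395881451895414467521900497, 420286494040082902764953414875598568497,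
    420048702594520715495317031743686406097]),
   ([-5, -3, -1, 1, 2, 2, 2, 3], [78, 36, 24, 60, 108, 594, 204, 162, 150, 126, 186, 222,
    424024705414387775452989153953022177089, 426, 306, 258, 414, 390, 294, 246,
    424024705414387775438921244869845479233, 85072539112665891922338424216672497617, 498, 450,
    330, 467922166744790795859894610256717676574, 282]),
   ([-5, -3, 1, 1, 1, 1, 2, 3], [90, 12, 24, 48, 96, 210, 486, 174, 162, 138, 186,
    655306237940328384258174220951003131137, 420056491128954931471041738460257872897, 246, 222,
    270, 294, 402, 234, 258, 306, 414, 342, 318, 438, 390,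
    340913717838764642592677530405617860638]),
   ([-5, -2, -2, 1, 1, 1, 3, 4], [78, 84, 24, 48, 96, 198, 498, 234, 150, 126, 174, 204,
    468886150316632914863115564151428296909, 156, 132, 180,
    468139447148049639989575224292104233009, 468886150316632914863115524569613676749, 282, 258,
    306, 426, 354, 450, 330, 402, 595495176781985631117820316530116456437]),
   ([-5, -2, -2, 1, 1, 2, 3, 3], [78, 84, 24, 48, 102, 198, 498, 186, 108, 126, 150, 204, 396,
    132, 156, 234, 474, 390, 282, 258, 306, 467904809732231660434363972385486365697,
    408093195940440357973561908084209837057, 450, 467905782380560170676658973200658214964, 426,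
    640685825085207033799653891354300252190]),
   ([-5, -2, -1, -1, 1, 2, 3, 4], [102, 60, 72, 48, 108, 198, 474, 162, 174, 150, 228, 330,
    340913231424888101496016239562986618910, 132, 120, 180, 210, 414, 222, 258, 282, 402, 270,
    426, 148629172774523570829798770848700526590, 483843854396264729371979621317105183745,
    483836054602065578527322496262013467697]),
   ([-5, -2, -1, -1, 2, 2, 3, 3], [54, 60, 72, 84, 102, 198, 522, 162, 174, 108, 186, 228, 420,
    210, 120, 222, 282, 414, 132, 420048702011450956988244886650169077956, 402,
    420048702011450956989308636730923954372, 420048702011450956989106186936303759556, 330, 474,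
    390, 468139675206317038180898034659658775601]),
   ([-5, -2, -1, 1, 1, 1, 3, 3], [78, 36, 24, 48, 96, 198, 498, 186, 150, 126, 174,
    420286315077590661441570883997834165297, 408323445657212851450470435980572638257, 60, 84, 108,
    210, 390, 132, 156, 234, 426, 258, 306, 450, 402, 420286494130143263754618751780054592513]),
   ([-5, -2, 1, 1, 1, 1, 2, 2], [42, 12, 24, 48, 96, 198, 486, 78, 66, 90, 114,
    404164413081722816064065560979298070544, 420099328989335445778773579627290963984, 150, 126,
    174, 210, 402, 138, 162, 222, 414, 246, 294, 438, 390,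
    168144096875496148966208560578573697054]),
   ([-5, -1, -1, -1, 1, 2, 3, 3], [54, 60, 72, 48, 102, 210, 474, 114, 126, 108, 162, 228, 420,
    132, 120, 174, 222, 414, 180, 186, 234, 402, 282, 426,
    408093196004518248849460995607622640641, 643347384619057395067677227905410196481,
    147873690076283493705598396843852251137]),
   ([-5, -1, -1, 1, 1, 2, 2, 2], [30, 36, 24, 48, 102, 198, 450, 90, 54, 78, 108, 204, 396, 60,
    84, 114, 210, 390, 138, 162, 234, 426, 258, 402, 659235828032275654025815701306461971457,
    148859008207451841516898882211842060286, 148620411011476884188457452682971594753]),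
   ([-4, -3, -2, 1, 1, 1, 2, 5], [174, 84, 24, 48, 96, 204, 498, 378, 246, 222, 270, 294,
    420056247978638122449173367089127251972, 156, 132, 180,
    404398810883894004054085533605584199729, 468889069766411311006477106403019350209, 228, 252,
    300, 426, 342, 450, 318, 402, 521052699281990583408044893520326033438]),
   ([-4, -3, -1, -1, 1, 2, 2, 5], [150, 60, 72, 48, 108, 204, 474, 306, 318, 294, 246, 426,
    144886886910200322513280286197478539265, 132, 120, 180, 216, 414, 354, 228, 402, 378, 276,
    366, 483843614914519451968540028570114735297, 420287224336811427681338840767651855409,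
    483842884758915180861973188943160556737]),
   ([-4, -3, -1, 1, 1, 2, 2, 3], [126, 36, 24, 48, 108, 594, 204, 186, 150, 174, 222, 474,
    132927606583830681313454643731004187649, 60, 84, 498, 294, 438, 450, 246, 306, 330, 270, 426,
    354, 408085649997397762135512702378764677892, 282]),
   ([-4, -3, 1, 1, 1, 1, 1, 3], [90, 12, 24, 48, 96, 582, 192, 174, 162, 138, 186, 234,
    85072599722210212681467973377080651585, 342, 318, 270, 402, 366, 306, 258, 414, 354, 486, 438,
    330, 390, 282]),
   ([-4, -3, 1, 1, 1, 1, 2, 2], [90, 12, 24, 48, 96, 582, 210, 174, 162, 138, 186,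
    405328537568077138125930425936735386817, 148625297922469965400233312232998452417, 246, 222,
    498, 294, 270, 534, 510, 462, 258, 486, 450, 234, 426, 306]),
   ([-4, -2, -2, -1, 1, 1, 3, 5], [150, 156, 72, 48, 96, 198, 522, 258, 222, 204, 270, 474,
    595496090203645169876147647846159544273, 228, 276, 318,
    467954456331179664398113391378839920653, 595496090203645169876147855392992194513, 120, 168,
    402, 378, 426, 306, 324, 354, 408323442167165076278463398765179985969])],
  [([-4, -2, -2, 1, 1, 1, 3, 3], [78, 84, 24, 48, 96, 198, 546, 234, 150, 126, 174, 204, 396,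
    156, 132, 180, 390, 467905048604272348840088046573721772036, 498, 522, 258, 474, 282, 306,
    450, 426, 148625522476107263147032470470023721156]),
   ([-4, -2, -1, -1, -1, 2, 3, 5], [102, 108, 120, 144, 132, 198, 474, 210, 222, 246, 228, 330,
    169642114459585176772215663180611190814, 156, 168, 264, 462, 366, 276, 252, 450, 354, 426,
    378, 420095432683176803311041353705690512397, 147877846758017158253095314079494716429,
    655306466059189756043048917010489589761]),
   ([-4, -2, -1, -1, 1, 2, 3, 3], [102, 60, 72, 48, 108, 198, 522, 162, 174, 150, 228, 474, 420,
    132, 120, 180, 210, 462, 222, 258, 282, 450, 270, 330,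
    144887813879527880522063848230275264753, 414, 147873693656348285331158377070866886654]),
   ([-4, -2, -1, 1, 1, 1, 2, 3], [78, 36, 24, 48, 96, 198, 498, 186, 150, 126, 174, 204,
    408085590112275998939297903929338978308, 60, 84, 108, 234, 390, 132, 156, 222, 426, 246, 294,
    450, 402, 85071626400751847914527077216954576849]),
   ([-4, -2, 1, 1, 1, 1, 1, 2], [42, 12, 24, 48, 96, 582, 192, 78, 66, 90, 114, 210,
    471872044295919302599287000467727659825, 150, 126, 174, 222, 402, 138, 162, 234, 414, 246,
    294, 438, 390, 486]),
   ([-4, -1, -1, -1, 1, 1, 3, 3], [54, 60, 72, 48, 96, 210, 522, 162, 174, 102, 150, 228, 420,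
    180, 108, 156, 222, 414, 120, 168, 234, 402, 282, 330, 474, 426,
    471877900886194503379080891436343505857]),
   ([-4, -1, -1, -1, 1, 2, 2, 3], [54, 60, 72, 48, 102, 198, 474, 114, 126, 108, 162, 204, 420,
    132, 120, 174, 210, 414, 180, 186, 216, 402, 258, 330, 426,
    148858947673127731505345610078135268289, 421029073472868294282838344215428871105]),
   ([-4, -1, -1, 1, 1, 1, 2, 2], [30, 36, 24, 48, 96, 198, 498, 90, 54, 78, 102, 204, 396, 60,
    84, 108, 210, 390, 126, 150, 234, 426, 258, 306, 450, 402,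
    421030046062948789268653702049614163966]),
   ([-4, -1, 1, 1, 1, 1, 1, 1], [18, 12, 24, 48, 96, 582, 192, 30, 42, 54, 102, 198, 384, 66, 78,
    114, 210, 402, 126, 150, 222, 414, 246, 294, 438, 390, 486]),
   ([-3, -3, -2, -1, 1, 2, 2, 5], [618, 108, 72, 48, 120, 150, 204, 414, 450, 474, 522, 402,
    408324187352526655308027261902833083137, 180, 156, 216, 294, 354, 318, 246, 324, 366, 252,
    408324187352526655325591300449578017537, 408324173047181703526338394328985002033,
    372308576143927512232579924336144482334, 276]),
   ([-3, -3, -2, 1, 1, 1, 1, 5], [594, 84, 24, 48, 96, 174, 192,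
    147881482145955251669029384332170456897, 426, 450, 498, 402,
    85072542675147839979083907434630898689, 156, 132, 180, 228,
    147881482145955251669029384328883221297, 300, 252, 342, 348, 270, 318, 324, 366, 276]),
   ([-3, -3, -2, 1, 1, 1, 2, 4], [594, 84, 24, 48, 96, 174, 204, 390, 522, 546, 498, 474,
    409066934203524222691838886644078571518, 156, 132, 180, 222, 378, 228, 252, 246, 300, 270,
    294, 450, 426, 144886901170180918708747977976258195454]),
   ([-3, -3, -1, -1, 1, 1, 2, 5], [522, 60, 72, 48, 96, 204, 246, 414, 402, 474, 426,
    420052855745631685915689302331442293761, 471876916753575645833340895791646782257, 180, 108,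
    156, 216, 354, 120, 168, 228, 366, 276, 294, 324, 342,
    420052855745631685915689302332247391236]),
   ([-3, -3, -1, -1, 1, 2, 2, 4], [618, 60, 72, 48, 108, 150, 204, 462, 450, 474, 522, 414,
    595496150099906523611741076126598968068, 132, 120, 180, 216, 306, 294, 228, 318, 354, 246,
    402, 390, 408324172378402920056479685841126634289, 276]),
   ([-3, -3, -1, 1, 1, 1, 1, 4], [594, 36, 24, 48, 96, 174, 192, 390, 426, 450, 498, 402,
    424025693008286359713080044642562499329, 60, 84, 108, 204, 378, 132, 156, 228, 342, 252, 300,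
    318, 366, 270]),
   ([-3, -3, -1, 1, 1, 2, 2, 2], [642, 36, 24, 48, 108, 126, 204, 582, 618, 594, 546, 474, 396,
    60, 84, 186, 294, 222, 174, 150, 462, 522, 498, 438, 643348357948217949824783918544490356749,
    414, 486]),
   ([-3, -3, 1, 1, 1, 1, 1, 2], [678, 12, 24, 48, 90, 96, 192, 594, 606, 630, 582, 534,
    408139196506006744144264611390004618241, 162, 138, 174, 186, 234, 462, 510, 426, 414, 498,
    450, 438, 402, 486]),
   ([-3, -2, -2, -2, 1, 1, 3, 5], [150, 156, 168, 48, 96, 198, 570, 258, 270, 204, 522, 474, 420,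
    276, 216, 318, 414, 366, 306, 354, 402, 643348540400715639224873546741340712976, 372, 324,
    404165157528046266354047077071695637761, 132924990152774202760189280616391524353,
    678071944017475902087532993608668938270])],
  [([-3, -2, -2, -1, -1, 1, 4, 5], [570, 222, 120, 144, 96, 210, 228,
    421033945290894718519467230432447183876, 546, 522, 468, 462,
    421033945290894718519467283002044726276, 246, 270, 366, 306,
    655311409821093618546725173190572653761, 276, 252, 330, 426, 450, 354, 402, 372,
    678067277201310335083879292417943273502]),
   ([-3, -2, -2, -1, -1, 2, 3, 5], [102, 108, 120, 144, 168, 198, 570, 468, 222, 246, 204, 462,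
    450, 228, 252, 264, 306, 366, 330, 426, 354, 372, 402,
    132924017548067882069179282377259672577, 132927666424642351493661788338370080577,
    132927666424642351479340538402468478977, 643348540400715585254532309881751126017]),
   ([-3, -2, -2, -1, 1, 1, 3, 4], [150, 156, 72, 48, 96, 198, 570, 258, 222, 204, 522, 474, 420,
    228, 270, 318, 414, 404398126337078044447720617299607040061, 120, 168, 498, 378, 276, 306,
    324, 354, 144887129347507359573766213068861485261]),
   ([-3, -2, -2, 1, 1, 1, 1, 4], [78, 84, 24, 48, 96, 594, 192, 378, 150, 126, 174, 222,
    659044691633979252045940831318738690241, 156, 132, 180, 228,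
    659044691633979252045940673055903736001, 294, 246, 426, 342, 498, 450, 318, 402, 270]),
   ([-3, -2, -2, 1, 1, 1, 2, 3], [78, 84, 24, 48, 96, 594, 198, 282, 150, 126, 174, 204, 396,
    156, 132, 180, 546, 390, 222, 522, 246, 474, 498, 294, 450, 426,
    483842884703444754085341508529633947637]),
   ([-3, -2, -1, -1, -1, 1, 3, 5], [570, 108, 120, 144, 96, 198, 228, 210, 222, 246, 474,
    658297244022904326995681192081046433601, 467922652935838898766400815122429771806, 252, 264,
    276, 462, 318, 330, 306, 450, 354, 426, 342, 366, 372,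
    467900910561620157144129412269088977668]),
   ([-3, -2, -1, -1, -1, 2, 3, 4], [102, 108, 120, 144, 132, 198, 570, 210, 222, 246, 228, 462,
    468, 156, 168, 264, 450, 366, 276, 252, 438, 354, 330, 426, 378,
    132924020400238434578696702182835568641, 132924990152947609146518690695462728641]),
   ([-3, -2, -1, -1, 1, 1, 2, 4], [150, 60, 72, 48, 96, 198, 522, 258, 270, 204, 246, 474,
    404354985417604165646832460998211821617, 180, 108, 156, 216, 414, 120, 168, 228, 402, 276,
    294, 324, 426, 404351167491680765762680832079585894404]),
   ([-3, -2, -1, -1, 1, 2, 2, 3], [102, 60, 72, 48, 108, 618, 198, 162, 174, 150, 204, 474, 420,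
    132, 120, 180, 216, 462, 306, 228, 450, 414, 246, 402, 390,
    595496332567255863357712365039288073229, 522]),
   ([-3, -2, -1, 1, 1, 1, 1, 3], [78, 36, 24, 48, 96, 594, 192, 186, 150, 126, 174, 222,
    659282543674408190865632280768963211253, 60, 84, 108, 204, 390, 132, 156, 228, 426, 246, 294,
    450, 402, 498]),
   ([-3, -2, -1, 1, 1, 1, 2, 2], [78, 36, 24, 48, 96, 594, 198, 186, 150, 126, 174, 204, 396, 60,
    84, 108, 546, 486, 132, 156, 222, 522, 246, 498, 234, 294, 474]),
   ([-3, -2, 0, 1, 1, 1, 1, 2], [78, 12, 24, 48, 96, 594, 192, 90, 150, 126, 174, 222,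
    659231614320886728142442746736935972916, 36, 60, 108, 582, 204, 294, 246, 426, 342, 498, 450,
    318, 402, 270]),
   ([-3, -2, 1, 1, 1, 1, 1, 1], [42, 12, 24, 48, 678, 96, 192, 78, 66, 90, 114, 210, 384, 150,
    126, 594, 174, 222, 630, 606, 162, 534, 582, 138, 234, 294, 246]),
   ([-3, -1, -1, -1, -1, 1, 3, 4], [102, 108, 120, 144, 96, 210, 570, 222, 228, 246, 234, 474,
    468, 252, 264, 270, 462, 366, 276, 258, 450, 354, 330, 426, 378, 372,
    132924990138150360452575770735146647553]),
   ([-3, -1, -1, -1, -1, 2, 2, 4], [102, 108, 120, 144, 114, 198, 474, 126, 132, 150, 204, 468,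
    330, 156, 168, 210, 462, 366, 450, 216, 426, 354, 240, 372, 378,
    408136523045742529770228317006382260237, 148859906045762777657174491898910109505]),
   ([-3, -1, -1, -1, 1, 1, 2, 3], [54, 60, 72, 48, 96, 198, 522, 162, 174, 102, 150, 204, 420,
    180, 108, 156, 210, 414, 120, 168, 216, 402, 258, 306, 474, 426,
    643347567097590752041001538141417386225]),
   ([-3, -1, -1, -1, 1, 2, 2, 2], [54, 60, 72, 48, 102, 618, 198, 114, 126, 108, 162, 204, 468,
    132, 120, 174, 210, 462, 180, 186, 216, 450, 258, 474, 330, 420, 522]),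
   ([-3, -1, -1, 0, 1, 1, 2, 2], [54, 60, 24, 48, 96, 198, 522, 162, 78, 102, 150, 204, 420, 84,
    108, 156, 210, 414, 72, 120, 222, 498, 258, 306, 474, 426,
    409070951075063008722839258451694075649])],
  [([-3, -1, -1, 1, 1, 1, 1, 2], [30, 36, 24, 48, 96, 594, 192, 90, 54, 78, 102, 198, 396, 60,
    84, 108, 204, 390, 126, 150, 222, 426, 246, 294, 450, 402, 498]),
   ([-3, -1, 0, 1, 1, 1, 1, 1], [30, 12, 24, 48, 96, 594, 192, 42, 54, 78, 102, 198, 396, 36, 60,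
    108, 582, 204, 126, 150, 222, 426, 246, 294, 450, 402, 498]),
   ([-2, -2, -2, -1, 1, 1, 1, 5], [618, 150, 72, 48, 96, 156, 192,
    408089564181893691379043860727933711108, 402, 474, 522, 426,
    408089564181893691379043863817293652993, 366, 294, 246, 342,
    408089564181893691379043860724964385793, 120, 168, 216, 372, 252, 300, 312, 348, 264]),
   ([-2, -2, -2, -1, 1, 1, 3, 3], [618, 150, 72, 48, 96, 156, 570, 516, 546, 204, 510, 462, 498,
    222, 198, 258, 468, 270, 120, 168, 228, 396, 276, 306, 450, 420,
    409071863838216162181640270764092448781]),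
   ([-2, -2, -2, 1, 1, 1, 1, 3], [690, 78, 24, 48, 84, 96, 192, 396, 618, 642, 594, 546, 390,
    150, 126, 174, 222, 378, 132, 156, 180, 228, 522, 474, 450, 426, 498]),
   ([-2, -2, -1, -1, -1, 1, 2, 5], [570, 108, 120, 144, 96, 198, 204, 462, 450, 426, 474,
    420052673188233144412330747844205211457, 348293958801858024791115902321019977758, 228, 252,
    216, 294, 306, 264, 240, 318, 348, 324, 342, 372, 360,
    420052673188233144412330747847212284932]),
   ([-2, -2, -1, -1, -1, 1, 3, 4], [570, 108, 120, 144, 96, 198, 228, 558, 546, 522, 468, 462,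
    468138534398770908658038433107353559089, 210, 222, 246, 306, 264, 438, 252, 426, 414, 276,
    450, 402, 372, 468138534398770908658038433111383961589]),
   ([-2, -2, -1, -1, -1, 2, 3, 3], [666, 102, 108, 120, 132, 144, 570, 558, 546, 522, 228, 438,
    468, 156, 168, 198, 456, 210, 222, 246, 444, 252, 264, 330, 276, 420,
    483835826484073390193615908291700875268]),
   ([-2, -2, -1, -1, 1, 1, 1, 4], [618, 60, 72, 48, 96, 150, 192, 414, 402, 474, 522, 426,
    132927667137739392064338523969800859646, 180, 108, 156, 204, 354, 120, 168, 216, 366, 246,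
    294, 300, 342, 252]),
   ([-2, -2, -1, -1, 1, 1, 2, 3], [618, 60, 72, 48, 96, 150, 570, 510, 498, 204, 522, 474, 420,
    180, 108, 156, 198, 258, 120, 168, 216, 270, 246, 276, 228, 294, 324]),
   ([-2, -2, -1, 0, 1, 1, 1, 3], [618, 60, 24, 48, 96, 150, 192, 414, 594, 474, 522, 426,
    404354981853250789800105453332135698436, 84, 108, 156, 204, 354, 72, 120, 174, 216, 246, 294,
    300, 342, 252]),
   ([-2, -2, -1, 1, 1, 1, 1, 2], [690, 36, 24, 48, 78, 96, 192, 582, 618, 642, 594, 546, 396, 60,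
    84, 108, 186, 204, 126, 150, 156, 222, 174, 132, 228, 474, 522]),
   ([-2, -2, 0, 1, 1, 1, 1, 1], [690, 12, 24, 48, 78, 96, 192, 678, 618, 642, 594, 546, 396, 36,
    60, 90, 108, 204, 126, 150, 174, 222, 498, 450, 474, 426, 522]),
   ([-2, -1, -1, -1, -1, 1, 2, 4], [102, 108, 120, 144, 96, 198, 570, 210, 222, 246, 204, 474,
    468, 228, 252, 216, 462, 318, 264, 240, 306, 450, 324, 330, 426, 342,
    148629172834238740590581180132812079105]),
   ([-2, -1, -1, -1, -1, 1, 3, 3], [102, 108, 120, 144, 96, 210, 570, 564, 558, 546, 228, 462,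
    522, 246, 222, 264, 468, 270, 234, 252, 456, 258, 276, 450, 330, 426,
    147878576913622622923725109898374233857]),
   ([-2, -1, -1, -1, -1, 2, 2, 3], [666, 102, 108, 120, 114, 144, 570, 126, 132, 150, 204, 462,
    468, 156, 168, 198, 456, 366, 450, 210, 426, 354, 216, 330, 372, 378, 240]),
   ([-2, -1, -1, -1, 0, 1, 2, 3], [102, 108, 120, 48, 96, 198, 570, 210, 222, 150, 204, 474, 468,
    228, 156, 216, 462, 318, 168, 306, 450, 330, 144, 246, 522, 324,
    420099331842649190906934711975241891841]),
   ([-2, -1, -1, -1, 1, 1, 1, 3], [54, 60, 72, 48, 96, 618, 192, 162, 174, 102, 150, 198, 420,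
    180, 108, 156, 204, 414, 120, 168, 216, 402, 246, 294, 474, 426, 522])],
  [([-2, -1, -1, -1, 1, 1, 2, 2], [54, 60, 72, 48, 96, 618, 570, 162, 174, 102, 150, 204, 516,
    180, 108, 156, 198, 510, 120, 168, 210, 498, 522, 258, 216, 306, 474]),
   ([-2, -1, -1, 0, 1, 1, 1, 2], [54, 60, 24, 48, 96, 618, 192, 162, 78, 102, 150, 198, 420, 84,
    108, 156, 204, 414, 72, 120, 594, 216, 246, 294, 474, 426, 522]),
   ([-2, -1, -1, 1, 1, 1, 1, 1], [30, 36, 24, 48, 690, 96, 192, 90, 54, 78, 102, 588, 198, 60,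
    84, 108, 582, 204, 126, 150, 618, 222, 594, 642, 546, 474, 522]),
   ([-2, -1, 0, 0, 1, 1, 1, 1], [54, 12, 24, 48, 96, 618, 192, 66, 78, 102, 150, 198, 420, 36,
    60, 108, 606, 204, 72, 120, 594, 216, 246, 294, 474, 426, 522]),
   ([-1, -1, -1, -1, -1, 1, 1, 4], [666, 102, 108, 120, 96, 144, 192, 468, 462, 450, 570, 474,
    426, 306, 318, 198, 294, 342, 324, 204, 300, 348, 216, 312, 360, 336, 240]),
   ([-1, -1, -1, -1, -1, 1, 2, 3], [666, 102, 108, 120, 96, 144, 570, 564, 558, 546, 204, 462,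
    522, 210, 222, 198, 468, 246, 228, 216, 306, 252, 240, 450, 264, 456, 426]),
   ([-1, -1, -1, -1, -1, 2, 2, 2], [666, 102, 108, 120, 660, 144, 570, 642, 654, 132, 618, 438,
    564, 114, 126, 150, 444, 198, 168, 156, 456, 204, 216, 330, 432, 420, 240]),
   ([-1, -1, -1, -1, 0, 1, 1, 3], [666, 102, 108, 48, 96, 120, 192, 468, 462, 618, 570, 474, 450,
    306, 150, 198, 294, 318, 156, 204, 300, 324, 144, 168, 216, 312, 240]),
   ([-1, -1, -1, -1, 0, 1, 2, 2], [666, 102, 108, 48, 96, 120, 570, 564, 558, 618, 204, 462, 546,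
    210, 150, 198, 468, 222, 156, 216, 306, 228, 144, 168, 522, 456, 450]),
   ([-1, -1, -1, -1, 1, 1, 1, 2], [714, 54, 60, 48, 72, 96, 192, 612, 606, 666, 618, 594, 570,
    162, 102, 150, 174, 198, 108, 156, 180, 204, 168, 120, 216, 474, 522]),
   ([-1, -1, -1, 0, 0, 1, 1, 2], [666, 102, 24, 48, 96, 108, 192, 468, 642, 618, 570, 474, 462,
    126, 150, 198, 294, 306, 72, 120, 132, 204, 144, 156, 216, 300, 240]),
   ([-1, -1, -1, 0, 1, 1, 1, 1], [714, 54, 24, 48, 60, 96, 192, 612, 690, 666, 618, 606, 570, 78,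
    102, 150, 162, 198, 72, 84, 108, 204, 156, 120, 216, 474, 522]),
   ([-1, -1, 0, 0, 0, 1, 1, 1], [666, 12, 24, 48, 96, 102, 192, 654, 642, 618, 570, 474, 468, 36,
    60, 108, 114, 198, 72, 120, 126, 204, 144, 150, 216, 294, 240]),
   ([-1, 0, 0, 0, 0, 0, 1, 1], [6, 12, 24, 48, 96, 192, 570, 18, 30, 54, 102, 198, 564, 36, 60,
    108, 204, 558, 72, 120, 216, 546, 144, 240, 522, 288, 474])]]

theorem check_certificates : ∀ x ∈ certificates, check x.1 x.2 = true := by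
  have h : (certificates.all fun x => check x.1 x.2) = true := by decide +kernel
  exact List.all_eq_true.1 h

/-! ### Counting orbits -/

/-- The vectors which arise from `b` by permuting the entries. -/
def rearrangements {n : ℕ} (b : Fin n → ℤ) : Finset (Fin n → ℤ) :=
  Finset.univ.image fun σ : Equiv.Perm (Fin n) => b ∘ σ

lemma mem_rearrangements {n : ℕ} {b b' : Fin n → ℤ} :
    b' ∈ rearrangements b ↔ ∃ σ : Equiv.Perm (Fin n), b ∘ σ = b' := by
  simp [rearrangements]

/-- This is the orbit-stabilizer theorem: the stabilizer of `b` is the product of the symmetric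
groups on the sets of positions with equal entries. -/
lemma card_rearrangements {n : ℕ} (b : Fin n → ℤ) : (rearrangements b).card *
    ∏ a ∈ Finset.univ.image b, (Fintype.card {i // b i = a}).factorial = n.factorial := by
  have h := Nat.card_congr (MulAction.orbitProdStabilizerEquivGroup
    (DomMulAct (Equiv.Perm (Fin n))) b)
  have h1 : Nat.card (DomMulAct (Equiv.Perm (Fin n))) = n.factorial := by
    rw [Nat.card_congr DomMulAct.mk.symm, Nat.card_eq_fintype_card, Fintype.card_perm,
      Fintype.card_fin]
  have h2 : MulAction.orbit (DomMulAct (Equiv.Perm (Fin n))) b = rearrangements b := by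
    ext b'
    rw [Finset.mem_coe, mem_rearrangements, MulAction.mem_orbit_iff]
    exact ⟨fun ⟨σ, h⟩ => ⟨DomMulAct.mk.symm σ, h⟩, fun ⟨σ, h⟩ => ⟨DomMulAct.mk σ, h⟩⟩
  have h3 : Nat.card (MulAction.stabilizer (DomMulAct (Equiv.Perm (Fin n))) b) =
      Nat.card {g : Equiv.Perm (Fin n) // b ∘ g = b} :=
    Nat.card_congr (Equiv.subtypeEquiv DomMulAct.mk.symm fun _ => Iff.rfl)
  rw [Nat.card_prod, h1, h2, h3, Nat.card_eq_fintype_card, Nat.card_eq_fintype_card,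
    DomMulAct.stabilizer_card'] at h
  simpa using h

lemma card_eq_count {n : ℕ} (b : Fin n → ℤ) (a : ℤ) :
    Fintype.card {i // b i = a} = (List.ofFn b).count a := by
  rw [Fintype.card_subtype, ← Multiset.coe_count, ← Fin.univ_val_map, Multiset.count_map,
    Finset.card_def, Finset.filter_val]
  simp only [eq_comm]

/-- The number of ways to arrange the entries of `l`. -/
def numRearrangements (l : List ℤ) : ℕ :=
  l.length.factorial / ∏ a ∈ l.toFinset, (l.count a).factorial

lemma ofFn_vec {l : List ℤ} (hl : l.length = 8) : List.ofFn (vec l) = l := by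
  refine List.ext_getElem (by rw [List.length_ofFn, hl]) fun i hi hi' => ?_
  rw [List.getElem_ofFn]
  exact List.getD_eq_getElem _ _ hi'

lemma card_rearrangements_vec {l : List ℤ} (hl : l.length = 8) :
    (rearrangements (vec l)).card = numRearrangements l := by
  have h := card_rearrangements (vec l)
  simp only [card_eq_count, ofFn_vec hl] at h
  rw [Fin.univ_image_def, ofFn_vec hl] at h
  rw [numRearrangements, hl, ← h]
  exact (Nat.mul_div_cancel _ (Finset.prod_pos fun a _ => Nat.factorial_pos _)).symm

/-- The coefficients of the listed inequalities, each of them in nondecreasing order. -/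
def reps : List (List ℤ) := certificates.map Prod.fst

lemma reps_nodup : reps.Nodup := by decide +kernel

lemma length_reps : reps.length = 86 := by decide +kernel

lemma sum_numRearrangements : (reps.map numRearrangements).sum = 298592 := by decide +kernel

lemma reps_spec : ∀ l ∈ reps,
    l.length = 8 ∧ l.SortedLE ∧ vec l 0 ≠ 0 ∧ vec l 6 ≠ 0 ∧ vec l 7 ≠ 0 := by
  decide +kernel

lemma hasTightBasis_of_mem_reps {l : List ℤ} (hl : l ∈ reps) : HasTightBasis (vec l) := by
  obtain ⟨x, hx, rfl⟩ := List.mem_map.1 hl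
  exact hasTightBasis_of_check (check_certificates x hx)

/-- `reps` as a finite set. -/
def repSet : Finset (List ℤ) := ⟨reps, reps_nodup⟩

lemma mem_repSet {l : List ℤ} : l ∈ repSet ↔ l ∈ reps := Iff.rfl

/-- The lists in `reps` are sorted, so distinct ones belong to distinct orbits. -/
lemma eq_of_vec_comp_eq {l l' : List ℤ} (hl : l ∈ reps) (hl' : l' ∈ reps)
    {σ τ : Equiv.Perm (Fin 8)} (h : vec l ∘ σ = vec l' ∘ τ) : l = l' := by
  have h1 := Equiv.Perm.ofFn_comp_perm σ (vec l)
  have h2 := Equiv.Perm.ofFn_comp_perm τ (vec l')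
  rw [ofFn_vec (reps_spec l hl).1] at h1
  rw [ofFn_vec (reps_spec l' hl').1, ← h] at h2
  exact List.Perm.eq_of_sortedLE (reps_spec l hl).2.1 (reps_spec l' hl').2.1 (h1.symm.trans h2)

/-- The entries of `vec l` at `0`, `6` and `7` are not zero, so the facet determines the vector. -/
lemma comp_eq_of_face_eq {l l' : List ℤ} (hl : l ∈ reps) (hl' : l' ∈ reps)
    {σ τ : Equiv.Perm (Fin 8)} (h : face (vec l ∘ σ) = face (vec l' ∘ τ)) :
    vec l ∘ σ = vec l' ∘ τ := by
  obtain ⟨-, -, h0, h6, h7⟩ := reps_spec l hl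
  refine ((hasTightBasis_of_mem_reps hl).comp σ).eq_of_face_eq
    ((hasTightBasis_of_mem_reps hl').comp τ) h (i := σ.symm 0) (j := σ.symm 6) (k := σ.symm 7)
    (by simp) (by simp) (by simp) ?_ ?_ ?_ <;> simpa

/-- The coefficients of the inequalities of all facets in the orbits of the listed ones. -/
def facetVectors : Finset (Fin 8 → ℤ) := repSet.biUnion fun l => rearrangements (vec l)

lemma mem_facetVectors {b : Fin 8 → ℤ} :
    b ∈ facetVectors ↔ ∃ l ∈ reps, ∃ σ : Equiv.Perm (Fin 8), vec l ∘ σ = b := by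
  simp only [facetVectors, Finset.mem_biUnion, mem_rearrangements, mem_repSet]

lemma card_facetVectors : facetVectors.card = 298592 := by
  rw [facetVectors, Finset.card_biUnion, ← sum_numRearrangements]
  · exact Finset.sum_congr rfl fun l hl => card_rearrangements_vec (reps_spec l (mem_repSet.1 hl)).1
  · intro l hl l' hl' hne
    refine Finset.disjoint_left.2 fun b hb hb' => hne ?_
    obtain ⟨σ, hσ⟩ := mem_rearrangements.1 hb
    obtain ⟨τ, hτ⟩ := mem_rearrangements.1 hb'
    exact eq_of_vec_comp_eq (mem_repSet.1 hl) (mem_repSet.1 hl') (hσ.trans hτ.symm)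

lemma face_injOn : Set.InjOn face (facetVectors : Set (Fin 8 → ℤ)) := by
  intro b hb b' hb' h
  obtain ⟨l, hl, σ, rfl⟩ := mem_facetVectors.1 (Finset.mem_coe.1 hb)
  obtain ⟨l', hl', τ, rfl⟩ := mem_facetVectors.1 (Finset.mem_coe.1 hb')
  exact comp_eq_of_face_eq hl hl' h

lemma face_mem_orbit {n : ℕ} (b : Fin n → ℤ) : face b ∈ orbit (face b) :=
  ⟨1, map_relabel_face 1 b⟩

lemma orbit_face_injOn : Set.InjOn (fun l => orbit (face (vec l))) (repSet : Set (List ℤ)) := by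
  intro l hl l' hl' h
  rw [Finset.mem_coe, mem_repSet] at hl hl'
  have hmem := face_mem_orbit (vec l')
  rw [← show orbit (face (vec l)) = orbit (face (vec l')) from h] at hmem
  obtain ⟨σ, hσ⟩ := hmem
  have hface : face (vec l ∘ σ) = face (vec l' ∘ (1 : Equiv.Perm (Fin 8))) :=
    (map_relabel_face σ _).symm.trans hσ
  exact eq_of_vec_comp_eq hl hl' (comp_eq_of_face_eq hl hl' hface)

lemma le_encard_facets : (298592 : ℕ∞) ≤ (facets (HYP 8)).encard := by
  have h : face '' (facetVectors : Set (Fin 8 → ℤ)) ⊆ facets (HYP 8) := by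
    rintro _ ⟨b, hb, rfl⟩
    obtain ⟨l, hl, σ, rfl⟩ := mem_facetVectors.1 (Finset.mem_coe.1 hb)
    exact ((hasTightBasis_of_mem_reps hl).comp σ).isFacet
  refine le_trans (le_of_eq ?_) (Set.encard_le_encard h)
  rw [face_injOn.encard_image, Set.encard_coe_eq_coe_finsetCard, card_facetVectors]
  rfl

lemma le_encard_facetOrbits : (86 : ℕ∞) ≤ (facetOrbits 8).encard := by
  have h : (fun l => orbit (face (vec l))) '' (repSet : Set (List ℤ)) ⊆ facetOrbits 8 := by
    rintro _ ⟨l, hl, rfl⟩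
    rw [Finset.mem_coe, mem_repSet] at hl
    exact Set.mem_image_of_mem orbit (hasTightBasis_of_mem_reps hl).isFacet
  refine le_trans (le_of_eq ?_) (Set.encard_le_encard h)
  rw [orbit_face_injOn.encard_image, Set.encard_coe_eq_coe_finsetCard,
    show repSet.card = 86 from length_reps]
  rfl

end Hypermetric

theorem mainTheorem2 :
    (298592 : ℕ∞) ≤ (Hypermetric.facets (Hypermetric.HYP 8)).encard ∧
      (86 : ℕ∞) ≤ (Hypermetric.facetOrbits 8).encard :=
  ⟨Hypermetric.le_encard_facets, Hypermetric.le_encard_facetOrbits⟩
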